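/- Let $\mathcal{A}$ be an (essentially) small additive category and $K$ a (commutative) field, and let $\mathcal{F}(\mathcal{A};K)$ be the category of all (not necessarily additive) functors from $\mathcal{A}$ to $K$-vector spaces. Definitions. A function $f:U\to V$ between abelian groups is polynomial of degree at most $d$ if $\sum_{I\subset\{1,\dots,d+1\}}(-1)^{d+1-|I|}f\big(\sum_{i\in I}u_i\big)=0$ for all $u_1,\dots,u_{d+1}\in U$, and polynomial if this holds for some $d\in\mathbb{N}$. A functor $F$ in $\mathcal{F}(\mathcal{A};K)$ is polyHomial if for all objects $x,y$ the function $\mathcal{A}(x,y)\to \mathrm{Hom}_K(F(x),F(y))$, $f\mapsto F(f)$, is polynomial; it is polynomial if there is a $d$ such that all these functions are polynomial of degree at most $d$. An ideal $\mathcal{I}$ of $\mathcal{A}$ (subgroups $\mathcal{I}(x,y)\subset\mathcal{A}(x,y)$ stable under composition on both sides with arbitrary morphisms) is $K$-cotrivial if for all $x,y$ the group $\mathcal{A}(x,y)/\mathcal{I}(x,y)$ is finite and $K\otimes_{\mathbb{Z}}\big(\mathcal{A}(x,y)/\mathcal{I}(x,y)\big)=0$. A functor in $\mathcal{F}(\mathcal{A};K)$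 is antipolynomial if, for some $K$-cotrivial ideal $\mathcal{I}$, it is isomorphic to the composite of the projection $\mathcal{A}\to\mathcal{A}/\mathcal{I}$ and a functor from $\mathcal{A}/\mathcal{I}$ to $K$-vector spaces. A bifunctor $B$ in $\mathcal{F}(\mathcal{A}\times\mathcal{A};K)$ is antipolynomial in the first variable if $B(-,x)$ is antipolynomial for every object $x$; it is polyHomial (resp. polynomial) in the second variable if $B(x,-)$ is polyHomial (resp. polynomial) for every object $x$. A functor $F$ is of finite type if every nonempty upward directed family of subfunctors of $F$ with union $F$ contains $F$; it is of cofinite type if every nonempty downward directed family of subfunctors of $F$ with zero intersection contains $0$; it is of finite length if it has a finite composition series. Let $\delta:\mathcal{A}\to\mathcal{A}\times\mathcal{A}$ be the diagonal functor and $\delta^*B=B\circ\delta$. Theorem. Let $F$ be a functor in $\mathcal{F}(\mathcal{A};K)$ all of whose values are finite-dimensional. 1. If $F$ is of finite type or of cofinite type, then there is a bifunctor $B$ in $\mathcal{F}(\mathcal{A}\times\mathcal{A};K)$ which is antipolynomial in the first variable and polyHomial in the second, such that $F\cong\delta^*B$. Moreover, such a $B$ is unique up to isomorphism. 2. If $F$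 is both of finite type and of cofinite type, then there is a bifunctor $B$ in $\mathcal{F}(\mathcal{A}\times\mathcal{A};K)$, unique up to isomorphism, which is antipolynomial in the first variable and polynomial in the second, such that $F\cong\delta^*B$; moreover, every bifunctor $B$ as in part 1 is then polynomial in the second variable. 3. If $F$ is of finite length, then $F$ is both of finite type and of cofinite type, so that part 2 applies. -/

import Mathlib

open CategoryTheory CategoryTheory.Limits

universe w v u k

namespace PolyFct

section PolynomialFunctions

variable {U V : Type*} [AddCommGroup U] [AddCommGroup V]

/-- The `d`-th deviation of a function `f : U → V` between abelian groups:
`(u₁, …, u_d) ↦ ∑_{I ⊆ {1, …, d}} (-1)^(d - |I|) f (∑_{i ∈ I} uᵢ)`. -/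
def deviation (d : ℕ) (f : U → V) (u : Fin d → U) : V :=
  ∑ I : Finset (Fin d), (-1 : ℤ) ^ (d - I.card) • f (∑ i ∈ I, u i)

/-- `f` is a polynomial function of degree at most `d` (in the sense of Eilenberg and Mac Lane):
its `(d + 1)`-st deviation vanishes identically. -/
def IsPolynomialFunOfDegreeLE (d : ℕ) (f : U → V) : Prop :=
  ∀ u : Fin (d + 1) → U, deviation (d + 1) f u = 0

/-- `f` is a polynomial function. -/
def IsPolynomialFun (f : U → V) : Prop :=
  ∃ d : ℕ, IsPolynomialFunOfDegreeLE d f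

end PolynomialFunctions

section Functors

variable {A : Type u} [Category.{v} A] [Preadditive A]
variable {K : Type k} [Field K]

/-- A functor is polynomial if, for some `d`, all the maps that it induces on the groups of
morphisms are polynomial functions of degree at most `d`. -/
def IsPolynomial (F : A ⥤ ModuleCat.{w} K) : Prop :=
  ∃ d : ℕ, ∀ x y : A, IsPolynomialFunOfDegreeLE d (fun f : x ⟶ y => F.map f)

/-- A functor is polyHomial if all the maps that it induces on the groups of morphisms are
polynomial functions, of a degree that may depend on the source and the target. -/
def IsPolyHomial (F : A ⥤ ModuleCat.{w} K) : Prop :=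
  ∀ x y : A, IsPolynomialFun (fun f : x ⟶ y => F.map f)

end Functors

/-- An ideal of a preadditive category: subgroups of the groups of morphisms, stable under
composition on either side with arbitrary morphisms. -/
structure CatIdeal (A : Type u) [Category.{v} A] [Preadditive A] where
  hom : ∀ x y : A, AddSubgroup (x ⟶ y)
  comp_mem_right : ∀ {x y z : A} (f : x ⟶ y) (g : y ⟶ z), f ∈ hom x y → f ≫ g ∈ hom x z
  comp_mem_left : ∀ {x y z : A} (f : x ⟶ y) (g : y ⟶ z), g ∈ hom y z → f ≫ g ∈ hom x z

namespace CatIdeal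

variable {A : Type u} [Category.{v} A] [Preadditive A]

/-- Two parallel morphisms are related if their difference lies in the ideal. -/
def homRel (I : CatIdeal A) : HomRel A :=
  fun x y f g => f - g ∈ I.hom x y

instance (I : CatIdeal A) : Congruence I.homRel where
  equivalence {x y} :=
    { refl := fun f => by
        change f - f ∈ I.hom x y
        rw [sub_self]
        exact (I.hom x y).zero_mem
      symm := fun {f g} h => by
        change g - f ∈ I.hom x y
        rw [← neg_sub]
        exact (I.hom x y).neg_mem h
      trans := fun {f g h} h₁ h₂ => by
        change f - h ∈ I.hom x y
        rw [← sub_add_sub_cancel f g h]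
        exact (I.hom x y).add_mem h₁ h₂ }
  comp_left f g g' h := by
    change f ≫ g - f ≫ g' ∈ I.hom _ _
    rw [← Preadditive.comp_sub]
    exact I.comp_mem_left _ _ h
  comp_right g h := by
    change _ ≫ g - _ ≫ g ∈ I.hom _ _
    rw [← Preadditive.sub_comp]
    exact I.comp_mem_right _ _ h

/-- The quotient category `A / I`: same objects, and morphisms `A(x, y) / I(x, y)`
(`homRel` is a congruence, so that passing to the quotient identifies nothing more). -/
abbrev QuotCat (I : CatIdeal A) : Type u := CategoryTheory.Quotient I.homRel

/-- The canonical functor `A ⥤ A / I`. -/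
abbrev proj (I : CatIdeal A) : A ⥤ I.QuotCat := CategoryTheory.Quotient.functor I.homRel

/-- An ideal is `K`-cotrivial if the groups `A(x, y) / I(x, y)` are finite and become zero after
tensoring with `K`. -/
def IsCotrivial (I : CatIdeal A) (K : Type k) [Field K] : Prop :=
  ∀ x y : A, Finite ((x ⟶ y) ⧸ I.hom x y) ∧
    Subsingleton (TensorProduct ℤ K ((x ⟶ y) ⧸ I.hom x y))

end CatIdeal

section Antipolynomial

variable {A : Type u} [Category.{v} A] [Preadditive A]
variable {K : Type k} [Field K]

/-- A functor is antipolynomial if it belongs to the essential image of precomposition with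
`A ⥤ A / I` for some `K`-cotrivial ideal `I`. -/
def IsAntipolynomial (F : A ⥤ ModuleCat.{w} K) : Prop :=
  ∃ I : CatIdeal A, I.IsCotrivial K ∧
    ((Functor.whiskeringLeft A I.QuotCat (ModuleCat.{w} K)).obj I.proj).essImage F

/-- The bifunctor `B` is antipolynomial in the first variable. -/
def IsAntipolynomialFst (B : A × A ⥤ ModuleCat.{w} K) : Prop :=
  ∀ x : A, IsAntipolynomial (Prod.sectL A x ⋙ B)

/-- The bifunctor `B` is polyHomial in the second variable. -/
def IsPolyHomialSnd (B : A × A ⥤ ModuleCat.{w} K) : Prop :=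
  ∀ x : A, IsPolyHomial (Prod.sectR x A ⋙ B)

/-- The bifunctor `B` is polynomial in the second variable. -/
def IsPolynomialSnd (B : A × A ⥤ ModuleCat.{w} K) : Prop :=
  ∀ x : A, IsPolynomial (Prod.sectR x A ⋙ B)

end Antipolynomial

section Finiteness

variable {A : Type u} [Category.{v} A]
variable {K : Type k} [Field K]

/-- All values of `F` are finite-dimensional. -/
def HasFiniteDimensionalValues (F : A ⥤ ModuleCat.{w} K) : Prop :=
  ∀ x : A, FiniteDimensional K (F.obj x)

/-- `F` is of finite type: every (nonempty) upward directed family of subfunctors of `F` with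
union `F` contains `F`. -/
def IsFiniteType (F : A ⥤ ModuleCat.{w} K) : Prop :=
  ∀ S : Set (Subobject F), S.Nonempty → DirectedOn (· ≤ ·) S → IsLUB S ⊤ → ⊤ ∈ S

/-- `F` is of cofinite type: every (nonempty) downward directed family of subfunctors of `F` with
zero intersection contains the zero subfunctor. -/
def IsCofiniteType (F : A ⥤ ModuleCat.{w} K) : Prop :=
  ∀ S : Set (Subobject F), S.Nonempty → DirectedOn (· ≥ ·) S → IsGLB S ⊥ → ⊥ ∈ S

/-- `F` has finite length: there is a finite composition series
`0 = F₀ ⊂ F₁ ⊂ ⋯ ⊂ Fₙ = F`, with no subfunctor strictly between two consecutive terms. -/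
def HasFiniteLength (F : A ⥤ ModuleCat.{w} K) : Prop :=
  ∃ (n : ℕ) (s : Fin (n + 1) → Subobject F),
    s 0 = ⊥ ∧ s (Fin.last n) = ⊤ ∧ ∀ i : Fin n, s i.castSucc ⋖ s i.succ

end Finiteness

end PolyFct

/-! Call a function `g (u, v)` on a group of morphisms split polynomial if it is periodic in `u`
under a subgroup of finite index whose quotient is killed by an integer invertible in `K`, and
polynomial in `v`. Such a `g` is determined by its diagonal (`IsSplitPolynomial.ext`): a polynomial
function vanishing on a subgroup of that kind is zero.

Existence is a Jordan decomposition. The functor turns `K[A(x, y)]` into a finite-dimensional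
commutative algebra `R`. Multiplication by integers on `A(x, y)` makes the characters of `R` stable
under powers. There are finitely many of them, so their values have bounded order, and `ρ : A(x, y)
→ Rˣ` factors as `ρ = σ τ` with `σ ^ N = 1`, `N` invertible in `K`, and `τ` unipotent, hence
polynomial. Then `σ(u) τ(v)` extends `ρ` off the diagonal (`exists_isSplitPolynomial`).

By uniqueness these extensions are compatible with composition, so `F` extends to the full
subcategory of `A × A` on the objects `(x, x)`. Every `(x, y)` is a retract of `(x ⊞ y, x ⊞ y)`, so
splitting idempotents gives `B` on all of `A × A`, uniquely. This part uses only finite-dimensional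
values.

Finite type means generation by one value, cofinite type cogeneration by one value. Either makes the
periods of `B` in the first variable uniform enough to form a cotrivial ideal; both together bound
the degree in the second variable by that of a single group of morphisms. -/

namespace PolyFct

/-! ### Polynomial functions and finite differences -/

section PolynomialFunctions

variable {U U' V V' : Type*} [AddCommGroup U] [AddCommGroup U'] [AddCommGroup V] [AddCommGroup V']

lemma deviation_zero (f : U → V) (u : Fin 0 → U) : deviation 0 f u = f 0 := by
  simp [deviation, Finset.univ_unique, Subsingleton.elim (default : Finset (Fin 0)) ∅]

/-- Separating the index sets according to whether they contain `0` exhibits deviations as iterated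
differences; every induction on the degree rests on this. -/
lemma deviation_succ (d : ℕ) (f : U → V) (u : Fin (d + 1) → U) :
    deviation (d + 1) f u = deviation d (fwdDiff (u 0) f) (fun i => u i.succ) := by
  unfold deviation
  have hinj : Function.Injective (fun I : Finset (Fin d) => I.map (Fin.succEmb d)) :=
    Finset.map_injective _
  have hinj' : Function.Injective
      (fun I : Finset (Fin d) => Finset.cons 0 (I.map (Fin.succEmb d)) (by simp)) := by
    intro I J h
    have h' := congrArg (fun S => Finset.erase S 0) h
    simpa [Finset.cons_eq_insert, Finset.erase_insert] using h'
  have huniv : (Finset.univ : Finset (Finset (Fin (d + 1)))) =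
      (Finset.univ.map ⟨_, hinj⟩).disjUnion (Finset.univ.map ⟨_, hinj'⟩) (by
        rw [Finset.disjoint_left]
        intro S hS hS'
        simp only [Finset.mem_map, Finset.mem_univ, true_and, Function.Embedding.coeFn_mk]
          at hS hS'
        obtain ⟨I, rfl⟩ := hS
        obtain ⟨J, hJ⟩ := hS'
        have h0 : (0 : Fin (d + 1)) ∈ I.map (Fin.succEmb d) := by
          rw [← hJ]; exact Finset.mem_cons_self _ _
        simp at h0) := by
    symm
    rw [Finset.eq_univ_iff_forall]
    intro S
    rw [Finset.mem_disjUnion]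
    simp only [Finset.mem_map, Finset.mem_univ, true_and, Function.Embedding.coeFn_mk]
    by_cases h : (0 : Fin (d + 1)) ∈ S
    · right
      refine ⟨Finset.univ.filter fun i => i.succ ∈ S, ?_⟩
      ext i
      refine Fin.cases ?_ (fun j => ?_) i <;> simp [h]
    · left
      refine ⟨Finset.univ.filter fun i => i.succ ∈ S, ?_⟩
      ext i
      refine Fin.cases ?_ (fun j => ?_) i <;> simp [h]
  rw [huniv, Finset.sum_disjUnion, Finset.sum_map, Finset.sum_map, ← Finset.sum_add_distrib]
  refine Finset.sum_congr rfl fun I _ => ?_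
  have hI : I.card ≤ d := by simpa using Finset.card_le_univ I
  simp only [Function.Embedding.coeFn_mk, Finset.card_map, Finset.card_cons, Finset.sum_map,
    Finset.sum_cons, Fin.coe_succEmb, fwdDiff, smul_sub]
  rw [show d + 1 - I.card = d - I.card + 1 by omega,
    show d + 1 - (I.card + 1) = d - I.card by omega, pow_succ, add_comm (u 0)]
  simp only [mul_neg, mul_one, neg_smul]
  abel

lemma isPolynomialFunOfDegreeLE_zero_iff (f : U → V) :
    IsPolynomialFunOfDegreeLE 0 f ↔ ∀ u, f u = f 0 := by
  simp only [IsPolynomialFunOfDegreeLE, deviation_succ, deviation_zero, fwdDiff, zero_add,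
    sub_eq_zero]
  exact ⟨fun h u => h fun _ => u, fun h u => h _⟩

lemma isPolynomialFunOfDegreeLE_succ_iff (d : ℕ) (f : U → V) :
    IsPolynomialFunOfDegreeLE (d + 1) f ↔ ∀ a, IsPolynomialFunOfDegreeLE d (fwdDiff a f) := by
  simp only [IsPolynomialFunOfDegreeLE]
  refine ⟨fun h a u => ?_, fun h u => ?_⟩
  · simpa [deviation_succ (d + 1)] using h (Fin.cons a u)
  · rw [deviation_succ]
    exact h _ _

lemma IsPolynomialFunOfDegreeLE.comp_map (d : ℕ) {f : U → V}
    (hf : IsPolynomialFunOfDegreeLE d f) (L : V →+ V') (a : U' →+ U) :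
    IsPolynomialFunOfDegreeLE d (fun u => L (f (a u))) := by
  intro u
  have h := congrArg L (hf fun i => a (u i))
  simpa [deviation, map_sum, map_zsmul] using h

lemma IsPolynomialFun.comp_map {f : U → V} (hf : IsPolynomialFun f) (L : V →+ V') (a : U' →+ U) :
    IsPolynomialFun (fun u => L (f (a u))) :=
  hf.imp fun d hd => hd.comp_map d L a

lemma IsPolynomialFunOfDegreeLE.succ {d : ℕ} {f : U → V} (hf : IsPolynomialFunOfDegreeLE d f) :
    IsPolynomialFunOfDegreeLE (d + 1) f := by
  induction d generalizing f with
  | zero =>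
    rw [isPolynomialFunOfDegreeLE_succ_iff]
    intro a u
    rw [isPolynomialFunOfDegreeLE_zero_iff] at hf
    simp [deviation_succ, deviation_zero, fwdDiff, hf a, hf (u 0), hf (u 0 + a)]
  | succ d ih =>
    rw [isPolynomialFunOfDegreeLE_succ_iff] at hf ⊢
    exact fun a => ih (hf a)

lemma IsPolynomialFunOfDegreeLE.mono {d e : ℕ} (h : d ≤ e) {f : U → V}
    (hf : IsPolynomialFunOfDegreeLE d f) : IsPolynomialFunOfDegreeLE e f := by
  induction h with
  | refl => exact hf
  | step _ ih => exact ih.succ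

lemma IsPolynomialFun.sub {f g : U → V} (hf : IsPolynomialFun f) (hg : IsPolynomialFun g) :
    IsPolynomialFun (fun u => f u - g u) := by
  obtain ⟨d, hd⟩ := hf
  obtain ⟨e, he⟩ := hg
  refine ⟨max d e, fun u => ?_⟩
  have h₁ := hd.mono (le_max_left d e) u
  have h₂ := he.mono (le_max_right d e) u
  have : deviation (max d e + 1) (fun u => f u - g u) u =
      deviation (max d e + 1) f u - deviation (max d e + 1) g u := by
    simp [deviation, smul_sub, Finset.sum_sub_distrib]
  rw [this, h₁, h₂, sub_zero]

lemma IsPolynomialFunOfDegreeLE.comp_add_left {d : ℕ} {f : U → V}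
    (hf : IsPolynomialFunOfDegreeLE d f) (a : U) :
    IsPolynomialFunOfDegreeLE d (fun u => f (a + u)) := by
  induction d generalizing f with
  | zero =>
    rw [isPolynomialFunOfDegreeLE_zero_iff] at hf ⊢
    intro u
    rw [hf, hf (a + 0)]
  | succ d ih =>
    rw [isPolynomialFunOfDegreeLE_succ_iff] at hf ⊢
    intro b
    have := ih (hf b)
    simp only [fwdDiff, add_assoc] at this
    exact this

/-- A polynomial function which is invariant under translation by a subgroup containing `n • U`,
where `n` acts injectively on the target, is constant. -/
lemma IsPolynomialFunOfDegreeLE.eq_zero_value_of_periodic {d : ℕ} {f : U → V}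
    (hf : IsPolynomialFunOfDegreeLE d f) (H : AddSubgroup U) (n : ℕ)
    (hn : ∀ x : V, n • x = 0 → x = 0) (hH : ∀ u, n • u ∈ H)
    (hper : ∀ u, ∀ h ∈ H, f (u + h) = f u) (u : U) : f u = f 0 := by
  induction d generalizing f u with
  | zero => exact (isPolynomialFunOfDegreeLE_zero_iff f).1 hf u
  | succ d ih =>
    rw [isPolynomialFunOfDegreeLE_succ_iff] at hf
    -- Differences of `f` are again periodic, hence constant by induction. So `f - f 0` is additive,
    -- and periodicity gives `n • (f u - f 0) = 0`.
    have hc : ∀ a v, f (v + a) - f v = f a - f 0 := by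
      intro a v
      have := ih (hf a) (fun v h hh => by
        simp only [fwdDiff]
        rw [add_right_comm, hper _ h hh, hper _ h hh]) v
      simpa [fwdDiff] using this
    have hk : ∀ k : ℕ, f (k • u) = f 0 + k • (f u - f 0) := by
      intro k
      induction k with
      | zero => simp
      | succ k ihk =>
        rw [succ_nsmul, succ_nsmul, ← add_assoc, ← ihk, ← hc u (k • u)]
        abel
    have h0 : f (n • u) = f 0 := by simpa using hper 0 _ (hH u)
    have := hk n
    rw [h0, left_eq_add] at this
    exact sub_eq_zero.1 (hn _ this)

/-- Differences along elements of `H` vanish on `H` and have lower degree, so they vanish everywhere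
by induction; thus `f` is `H`-periodic, hence constant. -/
lemma IsPolynomialFunOfDegreeLE.eq_zero_of_vanish {d : ℕ} {f : U → V}
    (hf : IsPolynomialFunOfDegreeLE d f) (H : AddSubgroup U) (n : ℕ)
    (hn : ∀ x : V, n • x = 0 → x = 0) (hH : ∀ u, n • u ∈ H)
    (hf0 : ∀ h ∈ H, f h = 0) (u : U) : f u = 0 := by
  induction d generalizing f u with
  | zero => rw [(isPolynomialFunOfDegreeLE_zero_iff f).1 hf u, hf0 0 H.zero_mem]
  | succ d ih =>
    have hper : ∀ u, ∀ h ∈ H, f (u + h) = f u := by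
      intro u h hh
      have := ih ((isPolynomialFunOfDegreeLE_succ_iff d f).1 hf h) (fun h' hh' => by
        simp [fwdDiff, hf0 _ (H.add_mem hh' hh), hf0 _ hh']) u
      exact sub_eq_zero.1 this
    rw [hf.eq_zero_value_of_periodic H n hn hH hper, hf0 0 H.zero_mem]

end PolynomialFunctions

/-! ### Cotrivial subgroups and split polynomial functions -/

section SplitPolynomial

variable (K : Type k) [Field K] {U U' : Type*} [AddCommGroup U] [AddCommGroup U']

/-- A subgroup `H` of `U` is `K`-cotrivial if it has finite index and `U / H` is annihilated by an
integer which is invertible in `K`. -/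
structure IsCotrivialSubgroup (H : AddSubgroup U) : Prop where
  finiteIndex : H.FiniteIndex
  exists_nsmul_mem : ∃ n : ℕ, (n : K) ≠ 0 ∧ ∀ u, n • u ∈ H

variable {K}

lemma IsCotrivialSubgroup.inf {H H' : AddSubgroup U} (h : IsCotrivialSubgroup K H)
    (h' : IsCotrivialSubgroup K H') : IsCotrivialSubgroup K (H ⊓ H') := by
  obtain ⟨hf, n, hn, hH⟩ := h
  obtain ⟨hf', n', hn', hH'⟩ := h'
  refine ⟨inferInstance, n * n', by simp [hn, hn'], fun u => ⟨?_, ?_⟩⟩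
  · rw [mul_nsmul']
    exact hH _
  · rw [mul_nsmul]
    exact hH' _

lemma finiteIndex_comap (H : AddSubgroup U) [H.FiniteIndex] (a : U' →+ U) :
    (H.comap a).FiniteIndex :=
  ⟨by
    rw [AddSubgroup.index_comap]
    exact (inferInstance : (H.addSubgroupOf a.range).FiniteIndex).index_ne_zero⟩

lemma IsCotrivialSubgroup.comap {H : AddSubgroup U} (h : IsCotrivialSubgroup K H) (a : U' →+ U) :
    IsCotrivialSubgroup K (H.comap a) := by
  obtain ⟨hf, n, hn, hH⟩ := h
  refine ⟨finiteIndex_comap H a, n, hn, fun u => ?_⟩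
  simpa using hH (a u)

lemma IsCotrivialSubgroup.mono {H H' : AddSubgroup U} (h : IsCotrivialSubgroup K H)
    (hle : H ≤ H') : IsCotrivialSubgroup K H' := by
  obtain ⟨hf, n, hn, hH⟩ := h
  exact ⟨AddSubgroup.finiteIndex_of_le hle, n, hn, fun u => hle (hH u)⟩

lemma IsCotrivialSubgroup.iInf_comap {ι : Type*} [Finite ι] {H : AddSubgroup U}
    (h : IsCotrivialSubgroup K H) (a : ι → U' →+ U) :
    IsCotrivialSubgroup K (⨅ i, H.comap (a i)) := by
  obtain ⟨hf, n, hn, hH⟩ := h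
  refine ⟨AddSubgroup.finiteIndex_iInf fun i => finiteIndex_comap H (a i), n, hn, fun u => ?_⟩
  rw [AddSubgroup.mem_iInf]
  intro i
  simpa using hH (a i u)

lemma exists_addMonoidHom_zmod_ne_zero (p : ℕ) [Fact p.Prime] (hU : ∀ u : U, p • u = 0) {u : U}
    (hu : u ≠ 0) : ∃ φ : U →+ ZMod p, φ u ≠ 0 := by
  let _ : Module (ZMod p) U := AddCommGroup.zmodModule (n := p) hU
  have : Module.Free (ZMod p) U := Module.Free.of_divisionRing _ _
  have : Module.Projective (ZMod p) U := Module.Projective.of_free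
  obtain ⟨φ, hφ⟩ := Module.Projective.exists_dual_ne_zero (ZMod p) hu
  exact ⟨φ.toAddMonoidHom, hφ⟩

-- The integer is the index. Were it zero in `K`, the characteristic `p` would divide the order of
-- `M = U / H`, so `M / pM` would be nonzero, and a nonzero linear form to `𝔽_p ⊆ K` would give a
-- nonzero map `K ⊗ M → K`.
open scoped TensorProduct in
lemma isCotrivialSubgroup_of_tensor (H : AddSubgroup U) (hfin : Finite (U ⧸ H))
    (hK : Subsingleton (TensorProduct ℤ K (U ⧸ H))) : IsCotrivialSubgroup K H := by
  have hfi : H.FiniteIndex := AddSubgroup.finiteIndex_of_finite_quotient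
  refine ⟨hfi, H.index, ?_, fun u => H.nsmul_index_mem u⟩
  intro h0
  set M := U ⧸ H with hM
  have hcard : H.index = Nat.card M := rfl
  obtain ⟨p, hp⟩ := CharP.exists K
  have hpd : p ∣ Nat.card M := by rwa [← hcard, ← CharP.cast_eq_zero_iff K p]
  have hp0 : p ≠ 0 := by
    rintro rfl
    exact Nat.card_pos.ne' (zero_dvd_iff.1 hpd)
  have hpp : Fact p.Prime := ⟨(CharP.char_is_prime_or_zero K p).resolve_right hp0⟩
  let P : AddSubgroup M := (nsmulAddMonoidHom p : M →+ M).range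
  have hpP : ∀ x : M ⧸ P, p • x = 0 := by
    intro x
    obtain ⟨x, rfl⟩ := QuotientAddGroup.mk_surjective x
    rw [← QuotientAddGroup.mk_nsmul, QuotientAddGroup.eq_zero_iff]
    exact ⟨x, rfl⟩
  -- Cauchy's theorem gives an element of order `p`, so multiplication by `p` is not injective on
  -- the finite group `M`, hence not surjective.
  have hPne : P ≠ ⊤ := by
    intro htop
    have hsurj : Function.Surjective (nsmulAddMonoidHom p : M →+ M) :=
      AddMonoidHom.range_eq_top.1 htop
    have hinj := Finite.injective_iff_surjective.2 hsurj
    have := Fintype.ofFinite M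
    obtain ⟨x, hx⟩ := exists_prime_addOrderOf_dvd_card' p hpd
    have : x = 0 := hinj (by simp [← hx, addOrderOf_nsmul_eq_zero])
    rw [this, addOrderOf_zero] at hx
    exact hpp.1.one_lt.ne hx
  obtain ⟨m, hm⟩ : ∃ m : M, m ∉ P := by
    by_contra! h
    exact hPne ((AddSubgroup.eq_top_iff' P).2 h)
  have hm' : (QuotientAddGroup.mk m : M ⧸ P) ≠ 0 := by
    rwa [Ne, QuotientAddGroup.eq_zero_iff]
  obtain ⟨φ, hφ⟩ := exists_addMonoidHom_zmod_ne_zero p hpP hm'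
  let ψ : M →+ K := (ZMod.castHom dvd_rfl K : ZMod p →+* K).toAddMonoidHom.comp
    (φ.comp (QuotientAddGroup.mk' P))
  have hψ : ψ m ≠ 0 := by
    change (ZMod.castHom dvd_rfl K : ZMod p →+* K) (φ (QuotientAddGroup.mk m)) ≠ 0
    rw [Ne, map_eq_zero_iff _ (RingHom.injective _)]
    exact hφ
  let T : TensorProduct ℤ K M →ₗ[ℤ] K :=
    TensorProduct.lift ((LinearMap.mul ℤ K).compl₂ ψ.toIntLinearMap)
  have hT : T (1 ⊗ₜ[ℤ] m) = ψ m :=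
    (TensorProduct.lift.tmul _ _).trans (one_mul (ψ m))
  apply hψ
  rw [← hT, Subsingleton.elim (1 ⊗ₜ[ℤ] m : TensorProduct ℤ K M) 0, map_zero]

lemma subsingleton_tensor_of_isCotrivialSubgroup (H : AddSubgroup U)
    (h : IsCotrivialSubgroup K H) : Subsingleton (TensorProduct ℤ K (U ⧸ H)) := by
  obtain ⟨-, n, hn, hH⟩ := h
  refine subsingleton_of_forall_eq 0 fun t => ?_
  induction t with
  | zero => rfl
  | add x y hx hy => rw [hx, hy, add_zero]
  | tmul a x =>
    obtain ⟨u, rfl⟩ := QuotientAddGroup.mk_surjective x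
    have ha : a = (n : ℤ) • (a / n) := by
      rw [zsmul_eq_mul, Int.cast_natCast, mul_div_cancel₀ _ hn]
    rw [ha, TensorProduct.smul_tmul, natCast_zsmul, ← QuotientAddGroup.mk_nsmul,
      (QuotientAddGroup.eq_zero_iff _).2 (hH u), TensorProduct.tmul_zero]

variable {V V' : Type*} [AddCommGroup V] [Module K V] [AddCommGroup V'] [Module K V']

variable (K) in
/-- A function of two variables in `U` which is invariant under translation by a `K`-cotrivial
subgroup in the first variable, and polynomial in the second one. -/
structure IsSplitPolynomial (g : U → U → V) : Prop where
  periodic : ∃ H : AddSubgroup U, IsCotrivialSubgroup K H ∧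
    ∀ u v, ∀ h ∈ H, g (u + h) v = g u v
  polynomial : ∀ u, IsPolynomialFun (g u)

lemma IsSplitPolynomial.comp_map₂ {g : U → U → V} (hg : IsSplitPolynomial K g) (L : V →ₗ[K] V')
    (a b : U' →+ U) : IsSplitPolynomial K (fun u v => L (g (a u) (b v))) := by
  obtain ⟨⟨H, hH, hper⟩, hpol⟩ := hg
  refine ⟨⟨H.comap a, hH.comap a, fun u v h hh => ?_⟩,
    fun u => (hpol (a u)).comp_map L.toAddMonoidHom b⟩
  rw [map_add, hper _ _ _ hh]

lemma IsSplitPolynomial.comp_map {g : U → U → V} (hg : IsSplitPolynomial K g) (L : V →ₗ[K] V')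
    (a : U' →+ U) : IsSplitPolynomial K (fun u v => L (g (a u) (a v))) :=
  hg.comp_map₂ L a a

/-- A split polynomial function of two variables is determined by its restriction to the
diagonal. -/
lemma IsSplitPolynomial.ext {g g' : U → U → V} (hg : IsSplitPolynomial K g)
    (hg' : IsSplitPolynomial K g') (h : ∀ u, g u u = g' u u) : g = g' := by
  obtain ⟨⟨H, hH, hper⟩, hpol⟩ := hg
  obtain ⟨⟨H', hH', hper'⟩, hpol'⟩ := hg'
  obtain ⟨-, n, hn, hmem⟩ := hH.inf hH'
  funext u v
  obtain ⟨d, hd⟩ := (hpol u).sub (hpol' u)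
  -- For `t` in `H ⊓ H'`, periodicity replaces `(u, u + t)` by the diagonal point `(u + t, u + t)`,
  -- where `g` and `g'` agree.
  have key := (hd.comp_add_left u).eq_zero_of_vanish (H ⊓ H') n (fun x hx => by
      rw [← Nat.cast_smul_eq_nsmul K] at hx
      exact (smul_eq_zero.1 hx).resolve_left hn) hmem (fun t ht => by
      rw [← hper u (u + t) t ht.1, ← hper' u (u + t) t ht.2, h, sub_self]) (v - u)
  simpa [sub_eq_zero] using key

end SplitPolynomial

/-! ### Jordan decomposition in finite-dimensional commutative algebras -/

section FiniteDimensionalAlgebra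

variable {K : Type k} [Field K] {R : Type*} [CommRing R] [Algebra K R]

/-- Every residue field of `R` is finite over `K`, so it embeds in the algebraic closure; hence `r`
lies in every prime. -/
lemma isNilpotent_of_forall_algHom_eq_zero [FiniteDimensional K R] (r : R)
    (h : ∀ χ : R →ₐ[K] AlgebraicClosure K, χ r = 0) : IsNilpotent r := by
  have := IsArtinianRing.of_finite K R
  rw [nilpotent_iff_mem_prime]
  intro P hP
  let _ : Field (R ⧸ P) := Ideal.Quotient.field P
  have : FiniteDimensional K (R ⧸ P) :=
    Module.Finite.of_surjective (Ideal.Quotient.mkₐ K P).toLinearMap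
      (Ideal.Quotient.mkₐ_surjective K P)
  let ι : (R ⧸ P) →ₐ[K] AlgebraicClosure K := IsAlgClosed.lift
  have h' : ι (Ideal.Quotient.mk P r) = 0 := h (ι.comp (Ideal.Quotient.mkₐ K P))
  rw [map_eq_zero_iff ι (RingHom.injective (ι : R ⧸ P →+* AlgebraicClosure K))] at h'
  exact Ideal.Quotient.eq_zero_iff_mem.1 h'

variable {U : Type*} [AddCommGroup U] {ρ : U → R}

/-- If the set of characters of `R`, restricted to `U`, is stable under taking powers, then the
image of `U` in `R` is unipotent up to torsion prime to the characteristic. -/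
lemma exists_isNilpotent_pow_sub_one [FiniteDimensional K R] (hρ0 : ρ 0 = 1)
    (hρ : ∀ a b, ρ (a + b) = ρ a * ρ b)
    (hpow : ∀ (χ : R →ₐ[K] AlgebraicClosure K) (n : ℕ),
      ∃ χ' : R →ₐ[K] AlgebraicClosure K, ∀ u, χ' (ρ u) = χ (ρ u) ^ n) :
    ∃ N : ℕ, (N : K) ≠ 0 ∧ ∀ u, IsNilpotent (ρ u ^ N - 1) := by
  have hne : ∀ (χ : R →ₐ[K] AlgebraicClosure K) u, χ (ρ u) ≠ 0 := by
    intro χ u h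
    have h1 : χ (ρ u * ρ (-u)) = 1 := by rw [← hρ, add_neg_cancel, hρ0, map_one]
    rw [map_mul, h, zero_mul] at h1
    exact zero_ne_one h1
  have htors : ∀ χ : R →ₐ[K] AlgebraicClosure K, ∃ n : ℕ, n ≠ 0 ∧ ∀ u, χ (ρ u) ^ n = 1 := by
    intro χ
    choose c hc using hpow χ
    -- There are only finitely many characters, so two distinct powers of `χ` coincide on `U`.
    obtain ⟨a, b, hab, hcab⟩ := Finite.exists_ne_map_eq_of_infinite c
    wlog hlt : a < b generalizing a b
    · exact this b a hab.symm hcab.symm (by omega)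
    refine ⟨b - a, by omega, fun u => ?_⟩
    have h1 : χ (ρ u) ^ a = χ (ρ u) ^ b := by rw [← hc, ← hc, hcab]
    rw [← Nat.sub_add_cancel hlt.le, pow_add] at h1
    exact mul_right_cancel₀ (pow_ne_zero a (hne χ u)) (by rw [← h1, one_mul])
  choose n hn0 hn using htors
  have := Fintype.ofFinite (R →ₐ[K] AlgebraicClosure K)
  have hprod : ∏ χ, n χ ≠ 0 := Finset.prod_ne_zero_iff.2 fun χ _ => hn0 χ
  obtain ⟨q, hq⟩ := ExpChar.exists K
  have hq' : ExpChar (AlgebraicClosure K) q :=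
    expChar_of_injective_algebraMap (algebraMap K (AlgebraicClosure K)).injective q
  -- The part `q ^ e` of the exponent can be discarded: in exponential characteristic `q`, a field
  -- has no nontrivial `q ^ e`-th roots of unity.
  obtain ⟨e, N, hN, heN⟩ : ∃ e N : ℕ, (N : K) ≠ 0 ∧ ∏ χ, n χ = q ^ e * N := by
    cases hq with
    | zero => exact ⟨0, _, Nat.cast_ne_zero.2 hprod, by simp⟩
    | prime hp =>
      obtain ⟨e, N, hN, h⟩ := Nat.exists_eq_pow_mul_and_not_dvd hprod q hp.one_lt.ne'
      exact ⟨e, N, by rwa [Ne, CharP.cast_eq_zero_iff K q], h⟩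
  refine ⟨N, hN, fun u => isNilpotent_of_forall_algHom_eq_zero (K := K) _ fun χ => ?_⟩
  rw [map_sub, map_pow, map_one, sub_eq_zero, ← ExpChar.pow_prime_pow_mul_eq_one_iff q e N, ← heN]
  obtain ⟨m, hm⟩ := Finset.dvd_prod_of_mem n (Finset.mem_univ χ)
  rw [hm, pow_mul, hn, one_pow]

/-- The multiplicative Jordan decomposition of a homomorphism from an abelian group to the group
of units of a finite-dimensional commutative algebra, with image unipotent up to torsion prime to
the characteristic. -/
lemma exists_jordan_decomposition (hρ0 : ρ 0 = 1) (hρ : ∀ a b, ρ (a + b) = ρ a * ρ b)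
    {N : ℕ} (hN : (N : K) ≠ 0) (hnil : ∀ u, IsNilpotent (ρ u ^ N - 1)) :
    ∃ σ τ : U → R, (∀ u, ρ u = σ u * τ u) ∧ (∀ a b, σ (a + b) = σ a * σ b) ∧
      (∀ a b, τ (a + b) = τ a * τ b) ∧ (∀ u, σ u ^ N = 1) ∧
      (∀ u, IsNilpotent (τ u - 1)) ∧ (∀ u v, IsNilpotent (σ u - σ v) → σ u = σ v) := by
  have hρu : ∀ u, ρ u * ρ (-u) = 1 := fun u => by rw [← hρ, add_neg_cancel, hρ0]
  have hNu : IsUnit (N : R) := by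
    rw [← map_natCast (algebraMap K R)]
    exact (IsUnit.mk0 _ hN).map _
  -- Newton's method for `X ^ N - 1`, whose derivative at `x` is a unit because `N` is invertible.
  -- Uniqueness of the root makes `σ` multiplicative and determined modulo nilpotents.
  have hex : ∀ x : R, IsUnit x → IsNilpotent (x ^ N - 1) →
      ∃! r, IsNilpotent (x - r) ∧ r ^ N = 1 := by
    intro x hx hxn
    have := Polynomial.existsUnique_nilpotent_sub_and_aeval_eq_zero (R := R) (S := R) (x := x)
      (P := Polynomial.X ^ N - 1) (by simpa using hxn)
      (by
        rw [Polynomial.derivative_sub, Polynomial.derivative_X_pow, Polynomial.derivative_one]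
        simpa using hNu.mul (hx.pow (N - 1)))
    simpa [sub_eq_zero] using this
  have hu : ∀ u, IsUnit (ρ u) := fun u => IsUnit.of_mul_eq_one _ (hρu u)
  choose σ hσ hσu using fun u => hex (ρ u) (hu u) (hnil u)
  have hσadd : ∀ a b, σ (a + b) = σ a * σ b := by
    intro a b
    refine (hσu (a + b) _ ⟨?_, by rw [mul_pow, (hσ a).2, (hσ b).2, mul_one]⟩).symm
    have h1 : ρ (a + b) - σ a * σ b = (ρ a - σ a) * ρ b + σ a * (ρ b - σ b) := by
      rw [hρ]; ring
    rw [h1]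
    exact (Commute.all _ _).isNilpotent_add
      ((Commute.all _ _).isNilpotent_mul_right (hσ a).1)
      ((Commute.all _ _).isNilpotent_mul_left (hσ b).1)
  have hσ0 : σ 0 = 1 := (hσu 0 1 ⟨by simp [hρ0], one_pow N⟩).symm
  have hσinv : ∀ u, σ u * σ (-u) = 1 := fun u => by rw [← hσadd, add_neg_cancel, hσ0]
  refine ⟨σ, fun u => ρ u * σ (-u), fun u => ?_, hσadd, fun a b => ?_, fun u => (hσ u).2,
    fun u => ?_, fun u v h => ?_⟩
  · rw [mul_left_comm, hσinv, mul_one]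
  · change ρ (a + b) * σ (-(a + b)) = ρ a * σ (-a) * (ρ b * σ (-b))
    rw [hρ, neg_add, hσadd]
    ring
  · rw [← hσinv u, ← sub_mul]
    exact (Commute.all _ _).isNilpotent_mul_right (hσ u).1
  · refine (hσu u _ ⟨?_, (hσ v).2⟩).symm
    rw [← sub_add_sub_cancel _ (σ u)]
    exact (Commute.all _ _).isNilpotent_add (hσ u).1 h

/-- The difference of `r τ` along `a` is `r (τ a - 1) τ`: each difference pushes the coefficient one
power deeper into the nilradical, which is a nilpotent ideal. -/
lemma isPolynomialFun_of_isNilpotent [IsArtinianRing R] {τ : U → R}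
    (hτ : ∀ a b, τ (a + b) = τ a * τ b) (hnil : ∀ u, IsNilpotent (τ u - 1)) (r : R) : IsPolynomialFun (fun v => r * τ v) := by
  obtain ⟨m, hm⟩ := IsArtinianRing.isNilpotent_nilradical (R := R)
  have key : ∀ (d j : ℕ), m ≤ j + d + 1 → ∀ r ∈ nilradical R ^ j,
      IsPolynomialFunOfDegreeLE d (fun v => r * τ v) := by
    intro d
    induction d with
    | zero =>
      intro j hj r hr
      have h1 : ∀ v, r * τ v = r := by
        intro v
        have : r * (τ v - 1) ∈ nilradical R ^ m :=
          Ideal.pow_le_pow_right hj (by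
            rw [pow_succ]
            exact Ideal.mul_mem_mul hr (mem_nilradical.2 (hnil v)))
        rw [hm, Ideal.zero_eq_bot, Ideal.mem_bot, mul_sub, mul_one, sub_eq_zero] at this
        exact this
      rw [isPolynomialFunOfDegreeLE_zero_iff]
      intro u
      rw [h1, h1]
    | succ d ih =>
      intro j hj r hr
      rw [isPolynomialFunOfDegreeLE_succ_iff]
      intro a
      have h1 := ih (j + 1) (by omega) (r * (τ a - 1)) (by
        rw [pow_succ]
        exact Ideal.mul_mem_mul hr (mem_nilradical.2 (hnil a)))
      have h2 : (fwdDiff a fun v => r * τ v) = fun v => r * (τ a - 1) * τ v := by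
        funext v
        rw [fwdDiff, hτ]
        ring
      rwa [h2]
  exact ⟨m, key m 0 (by omega) r (by simp)⟩

/-- The period subgroup is the kernel of `σ`. It contains `N • U`, and it has finite index because
`σ u` is determined by its images under the finitely many characters, which are `N`-th roots of
unity. -/
lemma isSplitPolynomial_of_jordan [FiniteDimensional K R] {N : ℕ} (hN : (N : K) ≠ 0) {σ τ : U → R}
    (hσ : ∀ a b, σ (a + b) = σ a * σ b) (hτ : ∀ a b, τ (a + b) = τ a * τ b)
    (hσN : ∀ u, σ u ^ N = 1) (hτnil : ∀ u, IsNilpotent (τ u - 1))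
    (hσu : ∀ u v, IsNilpotent (σ u - σ v) → σ u = σ v) :
    IsSplitPolynomial K (fun u v => σ u * τ v) := by
  have := IsArtinianRing.of_finite K R
  have hN0 : N ≠ 0 := by rintro rfl; simp at hN
  have hσ0 : σ 0 = 1 := by
    have h1 := hσ 0 0
    rw [add_zero] at h1
    have hunit : IsUnit (σ 0) := IsUnit.of_pow_eq_one (hσN 0) hN0
    exact (hunit.mul_eq_left.1 h1.symm)
  have hpow : ∀ (n : ℕ) u, σ (n • u) = σ u ^ n := by
    intro n u
    induction n with
    | zero => simp [hσ0]
    | succ n ih => rw [succ_nsmul, hσ, ih, pow_succ]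
  let H : AddSubgroup U :=
    { carrier := {u | σ u = 1}
      add_mem' := fun {a b} ha hb => by
        simp only [Set.mem_ofPred_eq] at ha hb ⊢
        rw [hσ, ha, hb, one_mul]
      zero_mem' := hσ0
      neg_mem' := fun {a} ha => by
        simp only [Set.mem_ofPred_eq] at ha ⊢
        rw [← hσ0, ← add_neg_cancel a, hσ, ha, one_mul] }
  refine ⟨⟨H, ⟨?_, N, hN, fun u => ?_⟩, fun u v h hh => ?_⟩,
    fun u => isPolynomialFun_of_isNilpotent hτ hτnil _⟩
  · have hroots : Finite {z : AlgebraicClosure K // z ^ N = 1} := by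
      have := NeZero.mk hN0
      refine Set.Finite.to_subtype (Set.Finite.subset
        (Polynomial.nthRootsFinset N (1 : AlgebraicClosure K)).finite_toSet fun z hz => ?_)
      rw [Finset.mem_coe, Polynomial.mem_nthRootsFinset (Nat.pos_of_ne_zero hN0)]
      exact hz
    have hfin : Finite (U ⧸ H) := by
      refine Finite.of_injective
        (fun (q : U ⧸ H) (χ : R →ₐ[K] AlgebraicClosure K) =>
          (⟨χ (σ q.out), by rw [← map_pow, hσN, map_one]⟩ :
            {z : AlgebraicClosure K // z ^ N = 1})) ?_
      intro q q' hqq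
      have h1 : σ q.out = σ q'.out := by
        refine hσu _ _ (isNilpotent_of_forall_algHom_eq_zero (K := K) _ fun χ => ?_)
        rw [map_sub, sub_eq_zero]
        exact congrArg Subtype.val (congrFun hqq χ)
      rw [← QuotientAddGroup.out_eq' q, ← QuotientAddGroup.out_eq' q', QuotientAddGroup.eq]
      change σ (-q.out + q'.out) = 1
      rw [hσ, ← h1, ← hσ, neg_add_cancel, hσ0]
    exact AddSubgroup.finiteIndex_of_finite_quotient
  · change σ (N • u) = 1
    rw [hpow, hσN]
  · change σ h = 1 at hh
    rw [hσ, hh, mul_one]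

end FiniteDimensionalAlgebra

/-! ### Extending a function off the diagonal -/

section Extension

variable {K : Type k} [Field K] {U V : Type*} [AddCommGroup U] [AddCommGroup V] [Module K V]
  [FiniteDimensional K V]

/-- A function from an abelian group to a finite-dimensional vector space is the restriction to
the diagonal of a split polynomial function, provided that its translates and its composites with
multiplications by integers are images of it under endomorphisms of the target. -/
lemma exists_isSplitPolynomial (f : U → V) (T : U → V →ₗ[K] V)
    (hT : ∀ a u, f (a + u) = T a (f u)) (D : ℕ → V →ₗ[K] V)
    (hD : ∀ n u, f (n • u) = D n (f u)) :
    ∃ g : U → U → V, IsSplitPolynomial K g ∧ ∀ u, g u u = f u := by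
  let M := MonoidAlgebra K (Multiplicative U)
  let e : U → M := fun u => MonoidAlgebra.of K (Multiplicative U) (Multiplicative.ofAdd u)
  have he0 : e 0 = 1 := rfl
  have he : ∀ a b, e (a + b) = e a * e b := fun a b =>
    map_mul (MonoidAlgebra.of K (Multiplicative U)) _ _
  have hspan : ∀ {W : Type _} [AddCommGroup W] [Module K W] (φ ψ : M →ₗ[K] W),
      (∀ u, φ (e u) = ψ (e u)) → φ = ψ := by
    intro W _ _ φ ψ h
    refine (MonoidAlgebra.basis (Multiplicative U) K).ext fun u => ?_
    rw [MonoidAlgebra.basis_apply]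
    exact h u.toAdd
  let ℓ : M →ₗ[K] V := (Finsupp.linearCombination K fun u : Multiplicative U => f u.toAdd) ∘ₗ
    (MonoidAlgebra.coeffLinearEquiv K).toLinearMap
  have hℓ : ∀ u, ℓ (e u) = f u := fun u =>
    (Finsupp.linearCombination_single K 1 (Multiplicative.ofAdd u)).trans (one_smul K (f u))
  have hℓT : ∀ a x, ℓ (e a * x) = T a (ℓ x) := fun a x =>
    LinearMap.congr_fun (hspan (ℓ ∘ₗ LinearMap.mulLeft K (e a)) (T a ∘ₗ ℓ) fun u => by
      simp [← he, hℓ, hT]) x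
  -- The kernel of `ℓ` is an ideal because translations act through `T`; the quotient then embeds in
  -- `V`, so it is finite-dimensional.
  let J : Ideal M :=
    { carrier := {x | ℓ x = 0}
      add_mem' := fun {x y} hx hy => by
        simp only [Set.mem_ofPred_eq] at hx hy ⊢
        rw [map_add, hx, hy, add_zero]
      zero_mem' := map_zero ℓ
      smul_mem' := fun c x hx => by
        simp only [Set.mem_ofPred_eq] at hx ⊢
        have := LinearMap.congr_fun (hspan (ℓ ∘ₗ LinearMap.mulRight K x) 0 fun u => by
          simp [hℓT, hx]) c
        simpa using this }
  let R := M ⧸ J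
  let π : M →ₐ[K] R := Ideal.Quotient.mkₐ K J
  have hπ : Function.Surjective π := Ideal.Quotient.mkₐ_surjective K J
  let L : R →ₗ[K] V := Submodule.liftQ (J.restrictScalars K) ℓ (fun x hx => hx)
  have hL : ∀ x, L (π x) = ℓ x := fun x => rfl
  have hLinj : Function.Injective L := by
    rw [injective_iff_map_eq_zero]
    intro r hr
    obtain ⟨x, rfl⟩ := hπ r
    rw [hL] at hr
    exact Ideal.Quotient.eq_zero_iff_mem.2 hr
  have hfd : FiniteDimensional K R := FiniteDimensional.of_injective L hLinj
  have hpow : ∀ (χ : R →ₐ[K] AlgebraicClosure K) (n : ℕ),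
      ∃ χ' : R →ₐ[K] AlgebraicClosure K, ∀ u, χ' (π (e u)) = χ (π (e u)) ^ n := by
    intro χ n
    -- The endomorphism of the group algebra induced by multiplication by `n` on `U` preserves `J`
    -- thanks to `D n`; composing `χ` with it gives the `n`-th power of `χ` on `U`.
    let ψ : M →ₐ[K] M := MonoidAlgebra.mapDomainAlgHom K K (powMonoidHom n)
    have hψ : ∀ u, ψ (e u) = e (n • u) := fun u => MonoidAlgebra.mapDomain_single
    have hψe : ∀ u, ψ (e u) = e u ^ n := fun u =>
      (hψ u).trans (map_pow (MonoidAlgebra.of K (Multiplicative U)) _ _)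
    have hℓψ : ∀ x, ℓ (ψ x) = D n (ℓ x) := fun x =>
      LinearMap.congr_fun (hspan (ℓ ∘ₗ ψ.toLinearMap) (D n ∘ₗ ℓ) fun u => by
        simp [hψ, hℓ, hD]) x
    refine ⟨Ideal.Quotient.liftₐ J (χ.comp (π.comp ψ)) fun x hx => ?_, fun u => ?_⟩
    · have h0 : π (ψ x) = 0 := Ideal.Quotient.eq_zero_iff_mem.2 (by
        change ℓ (ψ x) = 0
        rw [hℓψ, show ℓ x = 0 from hx, map_zero])
      simp [h0]
    · change χ (π (ψ (e u))) = _
      rw [hψe, map_pow, map_pow]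
  have hρ0 : π (e 0) = 1 := by rw [he0, map_one]
  have hρ : ∀ a b, π (e (a + b)) = π (e a) * π (e b) := fun a b => by rw [he, map_mul]
  obtain ⟨N, hN, hnil⟩ := exists_isNilpotent_pow_sub_one hρ0 hρ hpow
  obtain ⟨σ, τ, hστ, hσ, hτ, hσN, hτnil, hσu⟩ := exists_jordan_decomposition hρ0 hρ hN hnil
  refine ⟨fun u v => L (σ u * τ v),
    (isSplitPolynomial_of_jordan hN hσ hτ hσN hτnil hσu).comp_map L (AddMonoidHom.id U),
    fun u => ?_⟩
  change L (σ u * τ u) = f u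
  rw [← hστ, hL, hℓ]

end Extension

open scoped CategoryTheory.Prod

/-! ### From periods on each group of morphisms to cotrivial ideals -/

section Antipolynomial

variable {A : Type u} [Category.{v} A] [Preadditive A] {K : Type k} [Field K]

lemma IsAntipolynomial.exists_subgroup {G : A ⥤ ModuleCat.{w} K} (hG : IsAntipolynomial G)
    (x y : A) : ∃ H : AddSubgroup (x ⟶ y), IsCotrivialSubgroup K H ∧
      ∀ k, ∀ h ∈ H, G.map (k + h) = G.map k := by
  obtain ⟨I, hI, G', ⟨e⟩⟩ := hG
  refine ⟨I.hom x y, isCotrivialSubgroup_of_tensor _ (hI x y).1 (hI x y).2, fun k h hh => ?_⟩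
  have h1 : I.proj.map (k + h) = I.proj.map k := CategoryTheory.Quotient.sound _ (by
    change k + h - k ∈ I.hom x y
    rwa [add_sub_cancel_left])
  have h2 : (I.proj ⋙ G').map (k + h) = (I.proj ⋙ G').map k := congrArg G'.map h1
  rw [← cancel_epi (e.hom.app x), ← e.hom.naturality, ← e.hom.naturality]
  exact congrArg (· ≫ e.hom.app y) h2

/-- The largest ideal `I` such that a functor factors through `A / I`. -/
def periodIdeal {D : Type*} [Category D] (G : A ⥤ D) : CatIdeal A where
  hom x y :=
    { carrier := {h | ∀ (z z' : A) (a : z ⟶ x) (b : y ⟶ z') (k : z ⟶ z'),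
        G.map (k + a ≫ h ≫ b) = G.map k}
      add_mem' := fun {h h'} hh hh' z z' a b k => by
        rw [Preadditive.add_comp, Preadditive.comp_add, ← add_assoc, hh' z z' a b, hh z z' a b]
      zero_mem' := fun z z' a b k => by simp
      neg_mem' := fun {h} hh z z' a b k => by
        rw [← hh z z' a b (k + a ≫ (-h) ≫ b)]
        simp }
  comp_mem_right f g hf z z' a b k := by
    rw [Category.assoc]
    exact hf z z' a (g ≫ b) k
  comp_mem_left f g hg z z' a b k := by
    rw [Category.assoc, ← Category.assoc a]
    exact hg z z' (a ≫ f) b k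

lemma isAntipolynomial_of_periodIdeal (G : A ⥤ ModuleCat.{w} K)
    (h : ∀ x y, IsCotrivialSubgroup K ((periodIdeal G).hom x y)) : IsAntipolynomial G := by
  refine ⟨periodIdeal G, fun x y => ⟨?_, subsingleton_tensor_of_isCotrivialSubgroup _ (h x y)⟩,
    CategoryTheory.Quotient.lift _ G fun x y f g hfg => ?_,
    ⟨CategoryTheory.Quotient.lift.isLift _ _ _⟩⟩
  · have := (h x y).finiteIndex
    exact AddSubgroup.finite_quotient_of_finiteIndex
  · have := hfg x y (𝟙 x) (𝟙 y) g
    simpa using this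

/-- The morphisms from the values at `c` are jointly epimorphic. -/
def IsGeneratedBy {C : Type*} [Category C] {D : Type*} [Category D] (G : C ⥤ D) (c : C) : Prop :=
  ∀ ⦃x : C⦄ ⦃Z : D⦄ (a b : G.obj x ⟶ Z), (∀ g : c ⟶ x, G.map g ≫ a = G.map g ≫ b) → a = b

/-- The morphisms to the values at `c` are jointly monomorphic. -/
def IsCogeneratedBy {C : Type*} [Category C] {D : Type*} [Category D] (G : C ⥤ D) (c : C) :
    Prop :=
  ∀ ⦃x : C⦄ ⦃Z : D⦄ (a b : Z ⟶ G.obj x), (∀ g : x ⟶ c, a ≫ G.map g = b ≫ G.map g) → a = b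

variable [HasBinaryBiproducts A]

/-- A period subgroup given for each pair of objects need not be stable under composition.
Generation reduces the test to morphisms out of `c`, and a morphism `c ⟶ x` matters only modulo a
subgroup of finite index, so a finite intersection suffices. -/
lemma IsGeneratedBy.isCotrivialSubgroup_periodIdeal {D : Type*} [Category D] {G : A ⥤ D} {c : A}
    (hc : IsGeneratedBy G c)
    (hG : ∀ x y, ∃ H : AddSubgroup (x ⟶ y), IsCotrivialSubgroup K H ∧
      ∀ k, ∀ h ∈ H, G.map (k + h) = G.map k) (x y : A) :
    IsCotrivialSubgroup K ((periodIdeal G).hom x y) := by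
  have hloc : ∀ y : A, ∃ H : AddSubgroup (c ⟶ y), IsCotrivialSubgroup K H ∧
      ∀ h ∈ H, ∀ (z : A) (b : y ⟶ z) (k : c ⟶ z), G.map (k + h ≫ b) = G.map k := by
    intro y
    obtain ⟨H, hH, hper⟩ := hG c (c ⊞ y)
    refine ⟨_, hH.comap (Preadditive.rightComp c biprod.inr), fun h hh z b k => ?_⟩
    -- Composing this universal case with `biprod.desc k b` handles all `k` and `b` with one
    -- subgroup, independent of the target.
    have h1 : G.map (biprod.inl + h ≫ biprod.inr) = G.map biprod.inl := hper biprod.inl _ hh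
    have h2 := congrArg (· ≫ G.map (biprod.desc k b)) h1
    simpa [← Functor.map_comp] using h2
  choose H hH hper using hloc
  have := (hH x).finiteIndex
  have : Finite ((c ⟶ x) ⧸ H x) := AddSubgroup.finite_quotient_of_finiteIndex
  refine ((hH y).iInf_comap
    fun q : (c ⟶ x) ⧸ H x => Preadditive.leftComp y q.out).mono fun h hh => ?_
  have hall : ∀ (a : c ⟶ x) (z : A) (b : y ⟶ z) (k : c ⟶ z),
      G.map (k + a ≫ h ≫ b) = G.map k := by
    intro a z b k
    rw [AddSubgroup.mem_iInf] at hh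
    obtain ⟨d, hd⟩ := QuotientAddGroup.mk_out_eq_add (H x) a
    have hout : a = (QuotientAddGroup.mk a : (c ⟶ x) ⧸ H x).out + (-d : H x) := by
      rw [hd]; simp
    -- The correction `-d` lies in `H x`, so its composite with `h ≫ b` is a period; only the coset
    -- representative remains.
    rw [hout, Preadditive.add_comp, ← add_assoc, hper x _ (-d).2,
      ← hper y _ (hh (QuotientAddGroup.mk a)) z b k, ← Category.assoc]
    rfl
  intro z z' a b k
  refine hc _ _ fun g => ?_
  rw [← G.map_comp, ← G.map_comp, Preadditive.comp_add, ← Category.assoc g, hall]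

/-- Dual argument: the test is made after composition to `c`, and the universal case is a morphism
`c ⊞ x ⟶ c`. -/
lemma IsCogeneratedBy.isCotrivialSubgroup_periodIdeal {D : Type*} [Category D] {G : A ⥤ D} {c : A}
    (hc : IsCogeneratedBy G c)
    (hG : ∀ x y, ∃ H : AddSubgroup (x ⟶ y), IsCotrivialSubgroup K H ∧
      ∀ k, ∀ h ∈ H, G.map (k + h) = G.map k) (x y : A) :
    IsCotrivialSubgroup K ((periodIdeal G).hom x y) := by
  have hloc : ∀ x : A, ∃ H : AddSubgroup (x ⟶ c), IsCotrivialSubgroup K H ∧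
      ∀ h ∈ H, ∀ (z : A) (a : z ⟶ x) (k : z ⟶ c), G.map (k + a ≫ h) = G.map k := by
    intro x
    obtain ⟨H, hH, hper⟩ := hG (c ⊞ x) c
    refine ⟨_, hH.comap (Preadditive.leftComp c biprod.snd), fun h hh z a k => ?_⟩
    have h1 : G.map (biprod.fst + biprod.snd ≫ h) = G.map biprod.fst := hper biprod.fst _ hh
    have h2 := congrArg (G.map (biprod.lift k a) ≫ ·) h1
    simpa [← Functor.map_comp] using h2
  choose H hH hper using hloc
  have := (hH y).finiteIndex
  have : Finite ((y ⟶ c) ⧸ H y) := AddSubgroup.finite_quotient_of_finiteIndex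
  refine ((hH x).iInf_comap
    fun q : (y ⟶ c) ⧸ H y => Preadditive.rightComp x q.out).mono fun h hh => ?_
  have hall : ∀ (b : y ⟶ c) (z : A) (a : z ⟶ x) (k : z ⟶ c),
      G.map (k + a ≫ h ≫ b) = G.map k := by
    intro b z a k
    rw [AddSubgroup.mem_iInf] at hh
    obtain ⟨d, hd⟩ := QuotientAddGroup.mk_out_eq_add (H y) b
    have hout : b = (QuotientAddGroup.mk b : (y ⟶ c) ⧸ H y).out + (-d : H y) := by
      rw [hd]; simp
    rw [hout, Preadditive.comp_add, Preadditive.comp_add, ← add_assoc,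
      ← Category.assoc a h (-d : H y).1, hper y _ (-d).2,
      ← hper x _ (hh (QuotientAddGroup.mk b)) z a k]
    rfl
  intro z z' a b k
  refine hc _ _ fun g => ?_
  rw [← G.map_comp, ← G.map_comp, Preadditive.add_comp, Category.assoc, Category.assoc, hall]

end Antipolynomial

/-! ### Bifunctors with prescribed diagonal -/

section Bifunctor

variable {A : Type u} [Category.{v} A] {K : Type k} [Field K]

lemma map_eq_comp_snd (B : A × A ⥤ ModuleCat.{w} K) {x y x' y' : A} (f : x ⟶ x') (g : y ⟶ y') :
    B.map (f ×ₘ g) = B.map (f ×ₘ 𝟙 y) ≫ B.map (𝟙 x' ×ₘ g) := by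
  rw [← B.map_comp]
  congr 1
  ext <;> simp

lemma map_eq_comp_fst (B : A × A ⥤ ModuleCat.{w} K) {x y x' y' : A} (f : x ⟶ x') (g : y ⟶ y') :
    B.map (f ×ₘ g) = B.map (𝟙 x ×ₘ g) ≫ B.map (f ×ₘ 𝟙 y') := by
  rw [← B.map_comp]
  congr 1
  ext <;> simp

variable [Preadditive A]

lemma isSplitPolynomial_of_bifunctor {B : A × A ⥤ ModuleCat.{w} K} (h₁ : IsAntipolynomialFst B)
    (h₂ : IsPolyHomialSnd B) (x y : A) :
    IsSplitPolynomial K (fun u v : x ⟶ y => B.map (u ×ₘ v)) := by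
  refine ⟨?_, fun u => ?_⟩
  · obtain ⟨H, hH, hper⟩ := (h₁ x).exists_subgroup x y
    refine ⟨H, hH, fun u v h hh => ?_⟩
    rw [map_eq_comp_snd B (u + h), map_eq_comp_snd B u]
    exact congrArg (· ≫ B.map (𝟙 y ×ₘ v)) (hper u h hh)
  · have h : (fun v : x ⟶ y => B.map (u ×ₘ v)) =
        fun v => B.map (u ×ₘ 𝟙 x) ≫ B.map (𝟙 y ×ₘ v) := funext (map_eq_comp_snd B u)
    rw [h]
    exact (h₂ y x y).comp_map (Preadditive.leftComp (B.obj (y, y)) (B.map (u ×ₘ 𝟙 x)))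
      (AddMonoidHom.id _)

variable [HasBinaryBiproducts A] {B : A × A ⥤ ModuleCat.{w} K} {F : A ⥤ ModuleCat.{w} K}

/-- As `(x, y)` is a retract of `(x ⊞ y, x ⊞ y)`, where `B` is given by `F`, generation of `F` by
`c` passes to generation of `B` by `(c, c)`. -/
lemma IsGeneratedBy.map_eq (φ : F ≅ Functor.diag A ⋙ B) {c : A} (hc : IsGeneratedBy F c)
    {x y : A} {Z : ModuleCat.{w} K} (a b : B.obj (x, y) ⟶ Z)
    (h : ∀ (f : c ⟶ x) (g : c ⟶ y), B.map (f ×ₘ g) ≫ a = B.map (f ×ₘ g) ≫ b) : a = b := by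
  have hs : B.map ((biprod.inl : x ⟶ x ⊞ y) ×ₘ (biprod.inr : y ⟶ x ⊞ y)) ≫
      B.map ((biprod.fst : x ⊞ y ⟶ x) ×ₘ (biprod.snd : x ⊞ y ⟶ y)) = 𝟙 _ := by
    rw [← B.map_comp, ← B.map_id]
    congr 1
    ext <;> simp
  suffices hsuff : φ.hom.app (x ⊞ y) ≫ B.map (biprod.fst ×ₘ biprod.snd) ≫ a =
      φ.hom.app (x ⊞ y) ≫ B.map (biprod.fst ×ₘ biprod.snd) ≫ b by
    rw [cancel_epi] at hsuff
    have := congrArg (B.map ((biprod.inl : x ⟶ x ⊞ y) ×ₘ (biprod.inr : y ⟶ x ⊞ y)) ≫ ·) hsuff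
    simpa only [← Category.assoc, hs, Category.id_comp] using this
  refine hc _ _ fun g => ?_
  have hg : F.map g ≫ φ.hom.app (x ⊞ y) = φ.hom.app c ≫ B.map (g ×ₘ g) := φ.hom.naturality g
  have hcomp : B.map (g ×ₘ g) ≫ B.map ((biprod.fst : x ⊞ y ⟶ x) ×ₘ (biprod.snd : x ⊞ y ⟶ y)) =
      B.map ((g ≫ biprod.fst) ×ₘ (g ≫ biprod.snd)) := by
    rw [← B.map_comp]; rfl
  rw [reassoc_of% hg, reassoc_of% hg, reassoc_of% hcomp, reassoc_of% hcomp, h]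

lemma IsCogeneratedBy.map_eq (φ : F ≅ Functor.diag A ⋙ B) {c : A} (hc : IsCogeneratedBy F c)
    {x y : A} {Z : ModuleCat.{w} K} (a b : Z ⟶ B.obj (x, y))
    (h : ∀ (f : x ⟶ c) (g : y ⟶ c), a ≫ B.map (f ×ₘ g) = b ≫ B.map (f ×ₘ g)) : a = b := by
  have hs : B.map ((biprod.inl : x ⟶ x ⊞ y) ×ₘ (biprod.inr : y ⟶ x ⊞ y)) ≫
      B.map ((biprod.fst : x ⊞ y ⟶ x) ×ₘ (biprod.snd : x ⊞ y ⟶ y)) = 𝟙 _ := by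
    rw [← B.map_comp, ← B.map_id]
    congr 1
    ext <;> simp
  suffices hsuff : (a ≫ B.map (biprod.inl ×ₘ biprod.inr)) ≫ φ.inv.app (x ⊞ y) =
      (b ≫ B.map (biprod.inl ×ₘ biprod.inr)) ≫ φ.inv.app (x ⊞ y) by
    rw [cancel_mono] at hsuff
    have := congrArg (· ≫ B.map ((biprod.fst : x ⊞ y ⟶ x) ×ₘ (biprod.snd : x ⊞ y ⟶ y))) hsuff
    simpa only [Category.assoc, hs, Category.comp_id] using this
  refine hc _ _ fun g => ?_
  have hg : φ.inv.app (x ⊞ y) ≫ F.map g = B.map (g ×ₘ g) ≫ φ.inv.app c :=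
    (φ.inv.naturality g).symm
  have hcomp : B.map ((biprod.inl : x ⟶ x ⊞ y) ×ₘ (biprod.inr : y ⟶ x ⊞ y)) ≫ B.map (g ×ₘ g) =
      B.map ((biprod.inl ≫ g) ×ₘ (biprod.inr ≫ g)) := by
    rw [← B.map_comp]; rfl
  simp only [Category.assoc, hg]
  rw [reassoc_of% hcomp, reassoc_of% h]

/-- Every morphism `(c, c) ⟶ (x, y)` factors through `(c, y)`. -/
lemma IsGeneratedBy.sectL (φ : F ≅ Functor.diag A ⋙ B) {c : A} (hc : IsGeneratedBy F c) (y : A) :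
    IsGeneratedBy (Prod.sectL A y ⋙ B) c := by
  intro x Z (a : B.obj (x, y) ⟶ Z) (b : B.obj (x, y) ⟶ Z) h
  refine hc.map_eq φ a b fun f g => ?_
  rw [map_eq_comp_fst, Category.assoc, Category.assoc]
  exact congrArg (B.map (𝟙 c ×ₘ g) ≫ ·) (h f)

lemma IsGeneratedBy.sectR (φ : F ≅ Functor.diag A ⋙ B) {c : A} (hc : IsGeneratedBy F c) (x : A) :
    IsGeneratedBy (Prod.sectR x A ⋙ B) c := by
  intro y Z (a : B.obj (x, y) ⟶ Z) (b : B.obj (x, y) ⟶ Z) h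
  refine hc.map_eq φ a b fun f g => ?_
  rw [map_eq_comp_snd, Category.assoc, Category.assoc]
  exact congrArg (B.map (f ×ₘ 𝟙 c) ≫ ·) (h g)

lemma IsCogeneratedBy.sectL (φ : F ≅ Functor.diag A ⋙ B) {c : A} (hc : IsCogeneratedBy F c)
    (y : A) : IsCogeneratedBy (Prod.sectL A y ⋙ B) c := by
  intro x Z (a : Z ⟶ B.obj (x, y)) (b : Z ⟶ B.obj (x, y)) h
  refine hc.map_eq φ a b fun f g => ?_
  rw [map_eq_comp_snd, ← Category.assoc, ← Category.assoc]
  exact congrArg (· ≫ B.map (𝟙 c ×ₘ g)) (h f)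

lemma IsCogeneratedBy.sectR (φ : F ≅ Functor.diag A ⋙ B) {c : A} (hc : IsCogeneratedBy F c)
    (x : A) : IsCogeneratedBy (Prod.sectR x A ⋙ B) c := by
  intro y Z (a : Z ⟶ B.obj (x, y)) (b : Z ⟶ B.obj (x, y)) h
  refine hc.map_eq φ a b fun f g => ?_
  rw [map_eq_comp_fst, ← Category.assoc, ← Category.assoc]
  exact congrArg (· ≫ B.map (f ×ₘ 𝟙 c)) (h g)

omit [HasBinaryBiproducts A] in
/-- A polyHomial functor which is generated by its value at some object, and cogenerated by its
value at some object, is polynomial. -/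
lemma IsPolyHomial.isPolynomial (hF : IsPolyHomial F) {c c' : A} (hc : IsGeneratedBy F c)
    (hc' : IsCogeneratedBy F c') : IsPolynomial F := by
  obtain ⟨d, hd⟩ := hF c c'
  -- A deviation is detected between `F.map g` and `F.map g'`, and `u ↦ g ≫ u ≫ g'` is additive with
  -- values in the morphisms `c ⟶ c'`; so the degree there works for all `x` and `y`.
  refine ⟨d, fun x y u => hc _ _ fun g => hc' _ _ fun g' => ?_⟩
  have h1 := hd.comp_map d (AddMonoidHom.id _)
    ((Preadditive.leftComp c' g).comp (Preadditive.rightComp x g')) u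
  have h2 : ∀ D : F.obj x ⟶ F.obj y, (F.map g ≫ D) ≫ F.map g' =
      ((Preadditive.rightComp (F.obj c) (F.map g')).comp
        (Preadditive.leftComp (F.obj y) (F.map g))) D := fun D => rfl
  rw [h2, h2, map_zero, ← h1]
  simp only [deviation, map_sum, map_zsmul, AddMonoidHom.id_apply]
  refine Finset.sum_congr rfl fun I _ => ?_
  rw [← map_sum]
  change _ • ((F.map g ≫ F.map _) ≫ F.map g') = _ • F.map (g ≫ _ ≫ g')
  rw [F.map_comp, F.map_comp, Category.assoc]

end Bifunctor

/-! ### Construction and uniqueness of the bifunctor -/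

section SplitExtension

variable {A : Type u} [Category.{v} A] [Preadditive A] [HasBinaryBiproducts A]
variable {K : Type k} [Field K] {F : A ⥤ ModuleCat.{w} K}

/-- The extension result is applied to the graphs `(1, u) : x ⟶ x ⊞ y`, on which translations of `u`
act by shears and multiplication by `n` acts by `diag(1, n)`. Projecting to `y` recovers `F.map u`.
-/
lemma exists_splitExtension (hF : HasFiniteDimensionalValues F) (x y : A) :
    ∃ g : (x ⟶ y) → (x ⟶ y) → (F.obj x ⟶ F.obj y),
      IsSplitPolynomial K g ∧ ∀ u, g u u = F.map u := by
  have := hF x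
  have := hF (x ⊞ y)
  have : FiniteDimensional K (F.obj x ⟶ F.obj (x ⊞ y)) :=
    Module.Finite.equiv (ModuleCat.homLinearEquiv (S := K)).symm
  obtain ⟨g, hg, hgF⟩ := exists_isSplitPolynomial (K := K)
    (fun u : x ⟶ y => F.map (biprod.lift (𝟙 x) u))
    (fun a => Linear.rightComp K (F.obj x) (F.map (𝟙 (x ⊞ y) + biprod.fst ≫ a ≫ biprod.inr)))
    (fun a u => by
      rw [Linear.rightComp_apply, ← F.map_comp]
      congr 1
      ext <;> simp [add_comm])
    (fun n => Linear.rightComp K (F.obj x) (F.map (biprod.map (𝟙 x) (n • 𝟙 y))))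
    (fun n u => by
      rw [Linear.rightComp_apply, ← F.map_comp]
      congr 1
      ext <;> simp)
  refine ⟨_, hg.comp_map (Linear.rightComp K (F.obj x) (F.map biprod.snd)) (AddMonoidHom.id _),
    fun u => ?_⟩
  simp only [AddMonoidHom.id_apply]
  rw [hgF, Linear.rightComp_apply, ← F.map_comp, biprod.lift_snd]

/-- The split polynomial function of two variables which extends `u ↦ F.map u`. -/
noncomputable def splitExtension (hF : HasFiniteDimensionalValues F) {x y : A} (u v : x ⟶ y) :
    F.obj x ⟶ F.obj y :=
  (exists_splitExtension hF x y).choose u v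

variable (hF : HasFiniteDimensionalValues F)

lemma isSplitPolynomial_splitExtension (x y : A) :
    IsSplitPolynomial K (fun u v : x ⟶ y => splitExtension hF u v) :=
  (exists_splitExtension hF x y).choose_spec.1

lemma splitExtension_self {x y : A} (u : x ⟶ y) : splitExtension hF u u = F.map u :=
  (exists_splitExtension hF x y).choose_spec.2 u

/-- Uniqueness is used twice: in `(u', v')` when the first factor is diagonal, then in `(u, v)` for
fixed `(u', v')`. -/
lemma splitExtension_comp {x y z : A} (u v : x ⟶ y) (u' v' : y ⟶ z) :
    splitExtension hF (u ≫ u') (v ≫ v') = splitExtension hF u v ≫ splitExtension hF u' v' := by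
  have h₁ : ∀ (t : x ⟶ y) (u' v' : y ⟶ z),
      splitExtension hF (t ≫ u') (t ≫ v') = F.map t ≫ splitExtension hF u' v' := by
    intro t u' v'
    have := ((isSplitPolynomial_splitExtension hF x z).comp_map LinearMap.id
      (Preadditive.leftComp z t)).ext
      ((isSplitPolynomial_splitExtension hF y z).comp_map (Linear.leftComp K (F.obj z) (F.map t))
        (AddMonoidHom.id _)) fun s => by
          change splitExtension hF (t ≫ s) (t ≫ s) = F.map t ≫ splitExtension hF s s
          rw [splitExtension_self, splitExtension_self, F.map_comp]
    exact congrFun (congrFun this u') v'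
  have := ((isSplitPolynomial_splitExtension hF x z).comp_map₂ LinearMap.id
      (Preadditive.rightComp x u') (Preadditive.rightComp x v')).ext
      ((isSplitPolynomial_splitExtension hF x y).comp_map
        (Linear.rightComp K (F.obj x) (splitExtension hF u' v'))
        (AddMonoidHom.id _)) fun s => by
          change splitExtension hF (s ≫ u') (s ≫ v') =
            splitExtension hF s s ≫ splitExtension hF u' v'
          rw [splitExtension_self, h₁]
  exact congrFun (congrFun this u) v

lemma splitExtension_eq {B : A × A ⥤ ModuleCat.{w} K} (h₁ : IsAntipolynomialFst B)
    (h₂ : IsPolyHomialSnd B) (φ : ∀ x, F.obj x ≅ B.obj (x, x))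
    (hφ : ∀ {x y : A} (u : x ⟶ y), F.map u ≫ (φ y).hom = (φ x).hom ≫ B.map (u ×ₘ u))
    {x y : A} (u v : x ⟶ y) :
    splitExtension hF u v ≫ (φ y).hom = (φ x).hom ≫ B.map (u ×ₘ v) := by
  have := ((isSplitPolynomial_splitExtension hF x y).comp_map
      (Linear.rightComp K (F.obj x) (φ y).hom) (AddMonoidHom.id _)).ext
      ((isSplitPolynomial_of_bifunctor h₁ h₂ x y).comp_map
        (Linear.leftComp K (B.obj (y, y)) (φ x).hom) (AddMonoidHom.id _)) fun s => by
          change splitExtension hF s s ≫ (φ y).hom = (φ x).hom ≫ B.map (s ×ₘ s)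
          rw [splitExtension_self, hφ]
  exact congrFun (congrFun this u) v

/-- The value of the split extension of `F` on the morphism from `(x ⊞ y, x ⊞ y)` to
`(x' ⊞ y', x' ⊞ y')` which factors as `(x ⊞ y, x ⊞ y) ⟶ (x, y) ⟶ (x', y') ⟶ (x' ⊞ y', x' ⊞ y')`. -/
noncomputable def biprodMap {x y x' y' : A} (f : x ⟶ x') (g : y ⟶ y') :
    F.obj (x ⊞ y) ⟶ F.obj (x' ⊞ y') :=
  splitExtension hF (biprod.fst ≫ f ≫ biprod.inl) (biprod.snd ≫ g ≫ biprod.inr)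

lemma biprodMap_comp {x y x' y' x'' y'' : A} (f : x ⟶ x') (g : y ⟶ y') (f' : x' ⟶ x'')
    (g' : y' ⟶ y'') : biprodMap hF f g ≫ biprodMap hF f' g' = biprodMap hF (f ≫ f') (g ≫ g') := by
  rw [biprodMap, biprodMap, biprodMap, ← splitExtension_comp]
  simp

/-- The idempotent corresponds to the projector of `(x ⊞ y, x ⊞ y)` onto its retract `(x, y)`, so
its image is the only possible value of the bifunctor there. -/
lemma exists_splitting (x y : A) :
    ∃ (Y : ModuleCat.{w} K) (i : Y ⟶ F.obj (x ⊞ y)) (e : F.obj (x ⊞ y) ⟶ Y),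
      i ≫ e = 𝟙 Y ∧ e ≫ i = biprodMap hF (𝟙 x) (𝟙 y) :=
  IsIdempotentComplete.idempotents_split _ _ (by
    rw [biprodMap_comp, Category.comp_id, Category.comp_id])

/-- The value at `(x, y)` of the bifunctor associated with `F`. -/
noncomputable def bifunctorObj (x y : A) : ModuleCat.{w} K := (exists_splitting hF x y).choose

/-- The inclusion of the value at `(x, y)` of the bifunctor associated with `F`. -/
noncomputable def bifunctorι (x y : A) : bifunctorObj hF x y ⟶ F.obj (x ⊞ y) :=
  (exists_splitting hF x y).choose_spec.choose

/-- The projection to the value at `(x, y)` of the bifunctor associated with `F`. -/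
noncomputable def bifunctorπ (x y : A) : F.obj (x ⊞ y) ⟶ bifunctorObj hF x y :=
  (exists_splitting hF x y).choose_spec.choose_spec.choose

lemma bifunctorι_π (x y : A) : bifunctorι hF x y ≫ bifunctorπ hF x y = 𝟙 _ :=
  (exists_splitting hF x y).choose_spec.choose_spec.choose_spec.1

lemma bifunctorπ_ι (x y : A) :
    bifunctorπ hF x y ≫ bifunctorι hF x y = biprodMap hF (𝟙 x) (𝟙 y) :=
  (exists_splitting hF x y).choose_spec.choose_spec.choose_spec.2

lemma bifunctorι_biprodMap_id (x y : A) :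
    bifunctorι hF x y ≫ biprodMap hF (𝟙 x) (𝟙 y) = bifunctorι hF x y := by
  rw [← bifunctorπ_ι, ← Category.assoc, bifunctorι_π, Category.id_comp]

/-- The value of the bifunctor associated with `F` on a pair of morphisms. -/
noncomputable def bifunctorMap {x y x' y' : A} (f : x ⟶ x') (g : y ⟶ y') :
    bifunctorObj hF x y ⟶ bifunctorObj hF x' y' :=
  bifunctorι hF x y ≫ biprodMap hF f g ≫ bifunctorπ hF x' y'

lemma bifunctorπ_map {x y x' y' : A} (f : x ⟶ x') (g : y ⟶ y') :
    bifunctorπ hF x y ≫ bifunctorMap hF f g = biprodMap hF f g ≫ bifunctorπ hF x' y' := by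
  rw [bifunctorMap, reassoc_of% (bifunctorπ_ι hF x y), ← Category.assoc, biprodMap_comp,
    Category.id_comp, Category.id_comp]

/-- The bifunctor associated with a functor with finite-dimensional values. -/
noncomputable def bifunctor : A × A ⥤ ModuleCat.{w} K where
  obj p := bifunctorObj hF p.1 p.2
  map f := bifunctorMap hF f.1 f.2
  map_id p := by
    change bifunctorMap hF (𝟙 p.1) (𝟙 p.2) = _
    rw [bifunctorMap, reassoc_of% (bifunctorι_biprodMap_id hF p.1 p.2), bifunctorι_π]
  map_comp {p q r} f g := by
    change bifunctorMap hF (f.1 ≫ g.1) (f.2 ≫ g.2) = _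
    rw [bifunctorMap, bifunctorMap, Category.assoc, Category.assoc, bifunctorπ_map,
      reassoc_of% (biprodMap_comp hF f.1 f.2 g.1 g.2)]

lemma isPolyHomialSnd_bifunctor : IsPolyHomialSnd (bifunctor hF) := by
  intro x y y'
  exact ((isSplitPolynomial_splitExtension hF (x ⊞ y) (x ⊞ y')).polynomial
    (biprod.fst ≫ 𝟙 x ≫ biprod.inl)).comp_map
      ((Preadditive.leftComp _ (bifunctorι hF x y)).comp
        (Preadditive.rightComp _ (bifunctorπ hF x y')))
      ((Preadditive.leftComp _ (biprod.snd : x ⊞ y ⟶ y)).comp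
        (Preadditive.rightComp _ (biprod.inr : y' ⟶ x ⊞ y')))

/-- These periods depend on the pair `(x, x')`; turning them into an ideal requires (co)generation.
-/
lemma exists_subgroup_bifunctor (y x x' : A) :
    ∃ H : AddSubgroup (x ⟶ x'), IsCotrivialSubgroup K H ∧ ∀ k, ∀ h ∈ H,
      (Prod.sectL A y ⋙ bifunctor hF).map (k + h) = (Prod.sectL A y ⋙ bifunctor hF).map k := by
  obtain ⟨H, hH, hper⟩ := (isSplitPolynomial_splitExtension hF (x ⊞ y) (x' ⊞ y)).periodic
  let a : (x ⟶ x') →+ (x ⊞ y ⟶ x' ⊞ y) :=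
    (Preadditive.leftComp _ (biprod.fst : x ⊞ y ⟶ x)).comp
      (Preadditive.rightComp _ (biprod.inl : x' ⟶ x' ⊞ y))
  refine ⟨H.comap a, hH.comap a, fun k h hh => ?_⟩
  have h1 := hper (a k) (biprod.snd ≫ 𝟙 y ≫ biprod.inr) (a h) hh
  rw [← map_add] at h1
  exact congrArg (fun t => bifunctorι hF x y ≫ t ≫ bifunctorπ hF x' y) h1

/-- The value `F.obj x` is the value at `(x, x)` of the bifunctor associated with `F`. -/
noncomputable def diagBifunctorIsoApp (x : A) : F.obj x ≅ bifunctorObj hF x x where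
  -- The pairs `(inl, inr)` and `(fst, snd)` exhibit `(x, x)` as the retract of `(x ⊞ x, x ⊞ x)` cut
  -- out by the split idempotent.
  hom := splitExtension hF biprod.inl biprod.inr ≫ bifunctorπ hF x x
  inv := bifunctorι hF x x ≫ splitExtension hF biprod.fst biprod.snd
  hom_inv_id := by
    rw [Category.assoc, reassoc_of% (bifunctorπ_ι hF x x), biprodMap, ← splitExtension_comp,
      ← splitExtension_comp, ← F.map_id, ← splitExtension_self hF]
    simp
  inv_hom_id := by
    have h : splitExtension hF biprod.fst biprod.snd ≫
        splitExtension hF biprod.inl biprod.inr = biprodMap hF (𝟙 x) (𝟙 x) := by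
      rw [← splitExtension_comp, biprodMap, Category.id_comp, Category.id_comp]
    rw [Category.assoc, reassoc_of% h, reassoc_of% (bifunctorι_biprodMap_id hF x x),
      bifunctorι_π]

/-- A functor with finite-dimensional values is the diagonal of its associated bifunctor. -/
noncomputable def diagBifunctorIso : F ≅ Functor.diag A ⋙ bifunctor hF :=
  NatIso.ofComponents (diagBifunctorIsoApp hF) fun {x y} f => by
    change F.map f ≫ (diagBifunctorIsoApp hF y).hom =
      (diagBifunctorIsoApp hF x).hom ≫ bifunctorMap hF f f
    rw [diagBifunctorIsoApp, diagBifunctorIsoApp, Category.assoc, bifunctorπ_map,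
      ← Category.assoc, ← Category.assoc, ← splitExtension_self hF, biprodMap,
      ← splitExtension_comp, ← splitExtension_comp]
    simp

section Uniqueness

variable {B : A × A ⥤ ModuleCat.{w} K} (φ : ∀ x, F.obj x ≅ B.obj (x, x))

lemma map_inl_inr_comp {x y x' y' : A} (f : x ⟶ x') (g : y ⟶ y') :
    B.map ((biprod.inl : x ⟶ x ⊞ y) ×ₘ (biprod.inr : y ⟶ x ⊞ y)) ≫
      B.map ((biprod.fst ≫ f ≫ biprod.inl : x ⊞ y ⟶ x' ⊞ y') ×ₘ
        (biprod.snd ≫ g ≫ biprod.inr : x ⊞ y ⟶ x' ⊞ y')) =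
    B.map (f ×ₘ g) ≫ B.map (biprod.inl ×ₘ biprod.inr) := by
  rw [← B.map_comp, ← B.map_comp]
  congr 1
  ext <;> simp

lemma map_inl_inr_fst_snd (x y : A) :
    B.map ((biprod.inl : x ⟶ x ⊞ y) ×ₘ (biprod.inr : y ⟶ x ⊞ y)) ≫
      B.map (biprod.fst ×ₘ biprod.snd) = 𝟙 _ := by
  rw [← B.map_comp, ← B.map_id]
  congr 1
  ext <;> simp

lemma map_fst_snd_inl_inr (x y : A) :
    B.map ((biprod.fst : x ⊞ y ⟶ x) ×ₘ (biprod.snd : x ⊞ y ⟶ y)) ≫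
      B.map ((biprod.inl : x ⟶ x ⊞ y) ×ₘ (biprod.inr : y ⟶ x ⊞ y)) =
    B.map ((biprod.fst ≫ 𝟙 x ≫ biprod.inl : x ⊞ y ⟶ x ⊞ y) ×ₘ
      (biprod.snd ≫ 𝟙 y ≫ biprod.inr : x ⊞ y ⟶ x ⊞ y)) := by
  rw [← B.map_comp]
  congr 1
  ext <;> simp

variable (h₁ : IsAntipolynomialFst B) (h₂ : IsPolyHomialSnd B)
  (hφ : ∀ {x y : A} (u : x ⟶ y), F.map u ≫ (φ y).hom = (φ x).hom ≫ B.map (u ×ₘ u))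

include h₁ h₂ hφ in
lemma inv_comp_biprodMap {x y x' y' : A} (f : x ⟶ x') (g : y ⟶ y') :
    (φ (x ⊞ y)).inv ≫ biprodMap hF f g =
      B.map ((biprod.fst ≫ f ≫ biprod.inl) ×ₘ (biprod.snd ≫ g ≫ biprod.inr)) ≫
        (φ (x' ⊞ y')).inv := by
  rw [Iso.inv_comp_eq, ← Category.assoc, Iso.eq_comp_inv]
  exact splitExtension_eq hF h₁ h₂ φ hφ _ _

/-- The components of `PolyFct.isoBifunctor`. -/
noncomputable def isoBifunctorApp (x y : A) : B.obj (x, y) ≅ bifunctorObj hF x y where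
  -- Up to `φ`, both objects split the same idempotent of `F.obj (x ⊞ y)`.
  hom := B.map (biprod.inl ×ₘ biprod.inr) ≫ (φ (x ⊞ y)).inv ≫ bifunctorπ hF x y
  inv := bifunctorι hF x y ≫ (φ (x ⊞ y)).hom ≫ B.map (biprod.fst ×ₘ biprod.snd)
  hom_inv_id := by
    have h := inv_comp_biprodMap hF φ h₁ h₂ hφ (𝟙 x) (𝟙 y)
    rw [Category.assoc, Category.assoc, reassoc_of% (bifunctorπ_ι hF x y),
      ← Category.assoc (φ (x ⊞ y)).inv, h, Category.assoc, Iso.inv_hom_id_assoc,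
      ← Category.assoc, map_inl_inr_comp, Category.assoc, map_inl_inr_fst_snd, Category.comp_id]
    exact B.map_id (x, y)
  inv_hom_id := by
    have h := inv_comp_biprodMap hF φ h₁ h₂ hφ (𝟙 x) (𝟙 y)
    have h' := map_fst_snd_inl_inr (B := B) x y
    rw [Category.assoc, Category.assoc, ← Category.assoc (B.map _) (B.map _), h', ← Category.assoc (B.map _), ← h,
      Category.assoc, Iso.hom_inv_id_assoc,
      reassoc_of% (bifunctorι_biprodMap_id hF x y), bifunctorι_π]

/-- The bifunctor associated with `F` is the unique one, among the bifunctors which are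
antipolynomial in the first variable and polyHomial in the second one, whose diagonal is `F`. -/
noncomputable def isoBifunctor : B ≅ bifunctor hF :=
  NatIso.ofComponents (fun p => isoBifunctorApp hF φ h₁ h₂ hφ p.1 p.2) fun {p q} f => by
    obtain ⟨x, y⟩ := p
    obtain ⟨x', y'⟩ := q
    obtain ⟨f, g⟩ := f
    dsimp only at f g
    change B.map (f ×ₘ g) ≫ (isoBifunctorApp hF φ h₁ h₂ hφ x' y').hom =
      (isoBifunctorApp hF φ h₁ h₂ hφ x y).hom ≫ bifunctorMap hF f g
    have h := inv_comp_biprodMap hF φ h₁ h₂ hφ f g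
    have h' := map_inl_inr_comp (B := B) f g
    dsimp only [isoBifunctorApp]
    rw [Category.assoc, Category.assoc, bifunctorπ_map, ← Category.assoc (φ (x ⊞ y)).inv, h,
      Category.assoc, ← Category.assoc (B.map _), ← h', Category.assoc]

end Uniqueness

end SplitExtension

/-! ### Composition series and chain conditions -/

section FiniteLength

/-- A modular lattice with a finite composition series satisfies both chain conditions. -/
lemma wellFounded_of_covBy {L : Type*} [Lattice L] [BoundedOrder L] [IsModularLattice L] {n : ℕ}
    (s : Fin (n + 1) → L) (h0 : s 0 = ⊥) (hn : s (Fin.last n) = ⊤)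
    (hs : ∀ i : Fin n, s i.castSucc ⋖ s i.succ) : WellFoundedGT L ∧ WellFoundedLT L := by
  classical
  -- The indices of the composition factors that `a` hits. By modularity, comparable elements with
  -- the same index set are equal, so the cardinality is strictly monotone with values in a finite
  -- order.
  let J (a : L) : Finset (Fin n) :=
    Finset.univ.filter fun i => a ⊓ s i.succ ⊔ s i.castSucc = s i.succ
  have hle : ∀ (a : L) i, a ⊓ s (Fin.succ i) ⊔ s i.castSucc ≤ s i.succ := fun a i =>
    sup_le inf_le_right (hs i).le
  have hJ : ∀ a i, i ∉ J a → a ⊓ s (Fin.succ i) ⊔ s i.castSucc = s i.castSucc := by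
    intro a i hi
    have := (hs i).eq_or_eq le_sup_right (hle a i)
    exact this.resolve_right fun h => hi (by simp [J, h])
  have hmono : ∀ {a b : L}, a ≤ b → J a ⊆ J b := by
    intro a b hab i hi
    simp only [J, Finset.mem_filter, Finset.mem_univ, true_and] at hi ⊢
    refine le_antisymm (hle b i) ?_
    conv_lhs => rw [← hi]
    exact sup_le_sup_right (inf_le_inf_right _ hab) _
  have hinj : ∀ {a b : L}, a ≤ b → J a = J b → a = b := by
    intro a b hab hJab
    have key : ∀ i, a ⊓ s i = b ⊓ s i := by
      intro i
      induction i using Fin.induction with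
      | zero => rw [h0, inf_bot_eq, inf_bot_eq]
      | succ i ih =>
        have hcast : s i.castSucc ≤ s i.succ := (hs i).le
        refine eq_of_le_of_inf_le_of_sup_le (z := s i.castSucc) (inf_le_inf_right _ hab) ?_ ?_
        · rw [inf_assoc, inf_assoc, inf_eq_right.2 hcast, ih]
        · by_cases hi : i ∈ J b
          · have h1 : i ∈ J a := by rwa [hJab]
            simp only [J, Finset.mem_filter, Finset.mem_univ, true_and] at hi h1
            rw [hi, h1]
          · rw [hJ b i hi]
            exact le_sup_right
    have := key (Fin.last n)
    rwa [hn, inf_top_eq, inf_top_eq] at this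
  let ℓ (a : L) : Fin (n + 1) := ⟨(J a).card, by
    have := Finset.card_le_univ (J a)
    rw [Fintype.card_fin] at this
    omega⟩
  have hℓ : StrictMono ℓ := by
    intro a b hab
    change (J a).card < (J b).card
    refine Finset.card_lt_card ((hmono hab.le).ssubset_of_ne fun h => ?_)
    exact hab.ne (hinj hab.le h)
  exact ⟨hℓ.wellFoundedGT, hℓ.wellFoundedLT⟩

end FiniteLength

/-! ### Subfunctors, generation and cogeneration -/

section Subfunctors

variable {A : Type u} [Category.{v} A] {K : Type k} [Field K] {F : A ⥤ ModuleCat.{w} K}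

variable (F) in
/-- The lattice of families of subspaces of the values of `F` which are stable under the action of
the morphisms. -/
def stableFamilies : Sublattice (∀ x, Submodule K (F.obj x)) where
  carrier := {N | ∀ ⦃x y⦄ (f : x ⟶ y), (N x).map (F.map f).hom ≤ N y}
  supClosed' N hN N' hN' x y f := by
    rw [Pi.sup_apply, Submodule.map_sup]
    exact sup_le_sup (hN f) (hN' f)
  infClosed' N hN N' hN' x y f :=
    (Submodule.map_inf_le _).trans (inf_le_inf (hN f) (hN' f))

namespace stableFamilies

lemma map_mem (N : stableFamilies F) {x y : A} (f : x ⟶ y) {m : F.obj x} (hm : m ∈ N.1 x) :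
    F.map f m ∈ N.1 y :=
  N.2 f (Submodule.mem_map_of_mem hm)

/-- The functor whose values are the members of a stable family. -/
@[simps]
def toFunctor (N : stableFamilies F) : A ⥤ ModuleCat.{w} K where
  obj x := ModuleCat.of K (N.1 x)
  map f := ModuleCat.ofHom ((F.map f).hom.restrict fun _ hm => map_mem N f hm)

/-- The inclusion of a stable family of subspaces. -/
@[simps]
def ι (N : stableFamilies F) : toFunctor N ⟶ F where
  app x := ModuleCat.ofHom (N.1 x).subtype

instance (N : stableFamilies F) : Mono (ι N) := by
  have : ∀ x, Mono ((ι N).app x) := fun x => by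
    rw [ModuleCat.mono_iff_injective]
    exact (N.1 x).injective_subtype
  exact NatTrans.mono_of_mono_app _

/-- The images of the components of a natural transformation. -/
def range {G : A ⥤ ModuleCat.{w} K} (φ : G ⟶ F) : stableFamilies F :=
  ⟨fun x => LinearMap.range (φ.app x).hom, by
    rintro x y f _ ⟨_, ⟨m, rfl⟩, rfl⟩
    exact ⟨G.map f m, ConcreteCategory.congr_hom (φ.naturality f) m⟩⟩

lemma range_ι (N : stableFamilies F) : range (ι N) = N :=
  Subtype.ext (funext fun x => (N.1 x).range_subtype)

lemma range_comp_le {G G' : A ⥤ ModuleCat.{w} K} (φ : G ⟶ F) (ψ : G' ⟶ G) :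
    range (ψ ≫ φ) ≤ range φ := by
  rintro x _ ⟨m, rfl⟩
  exact ⟨ψ.app x m, rfl⟩

lemma exists_lift {G G' : A ⥤ ModuleCat.{w} K} (φ : G ⟶ F) [Mono φ] (ψ : G' ⟶ F)
    (h : range ψ ≤ range φ) : ∃ θ : G' ⟶ G, θ ≫ φ = ψ := by
  have hinj : ∀ x, Function.Injective (φ.app x).hom := fun x =>
    (ModuleCat.mono_iff_injective (φ.app x)).1 inferInstance
  have hex : ∀ x, ∃ θ : G'.obj x ⟶ G.obj x, θ ≫ φ.app x = ψ.app x := by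
    intro x
    refine ⟨ModuleCat.ofHom ((LinearEquiv.ofInjective _ (hinj x)).symm.toLinearMap ∘ₗ
      (ψ.app x).hom.codRestrict _ fun m => h x ⟨m, rfl⟩), ?_⟩
    ext m
    exact congrArg Subtype.val ((LinearEquiv.ofInjective _ (hinj x)).apply_symm_apply _)
  choose θ hθ using hex
  refine ⟨{ app := θ, naturality := fun x y f => ?_ }, by ext x : 2; exact hθ x⟩
  rw [← cancel_mono (φ.app y), Category.assoc, Category.assoc, hθ, φ.naturality,
    reassoc_of% (hθ x), ψ.naturality]

variable (F) in
/-- Subobjects of a functor correspond to stable families of subspaces of its values. -/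
noncomputable def subobjectOrderIso : Subobject F ≃o stableFamilies F where
  toFun T := range T.arrow
  invFun N := Subobject.mk (ι N)
  left_inv T := by
    refine le_antisymm ?_ ?_
    · obtain ⟨θ, hθ⟩ := exists_lift T.arrow (ι (range T.arrow)) (range_ι _).le
      exact Subobject.mk_le_of_comm θ hθ
    · obtain ⟨θ, hθ⟩ := exists_lift (ι (range T.arrow)) T.arrow (range_ι _).ge
      exact Subobject.le_mk_of_comm θ hθ
  right_inv N := by
    refine le_antisymm ?_ ?_
    · change range (Subobject.mk (ι N)).arrow ≤ N
      rw [← Subobject.underlyingIso_hom_comp_eq_mk]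
      exact (range_comp_le _ _).trans (range_ι N).le
    · conv_lhs => rw [← range_ι N, ← Subobject.underlyingIso_arrow (ι N)]
      exact range_comp_le _ _
  map_rel_iff' {T T'} := by
    refine ⟨fun h => ?_, fun h => ?_⟩
    · obtain ⟨θ, hθ⟩ := exists_lift T'.arrow T.arrow h
      exact Subobject.le_of_comm θ hθ
    · change range T.arrow ≤ range T'.arrow
      rw [← Subobject.ofLE_arrow h]
      exact range_comp_le _ _

/-- The subfunctor generated by the value at `c`. -/
def generatedBy (F : A ⥤ ModuleCat.{w} K) (c : A) : stableFamilies F :=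
  ⟨fun x => ⨆ g : c ⟶ x, LinearMap.range (F.map g).hom, fun x y f => by
    rw [Submodule.map_iSup]
    refine iSup_le fun g => ?_
    refine le_trans ?_ (le_iSup _ (g ≫ f))
    rintro _ ⟨_, ⟨m, rfl⟩, rfl⟩
    exact ⟨m, by simp⟩⟩

lemma generatedBy_le {N : stableFamilies F} {c : A} :
    generatedBy F c ≤ N ↔ N.1 c = ⊤ := by
  refine ⟨fun h => top_unique fun m _ => ?_, fun h x => iSup_le fun g => ?_⟩
  · exact h c (Submodule.mem_iSup_of_mem (𝟙 c) ⟨m, by simp⟩)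
  · rintro _ ⟨m, rfl⟩
    exact map_mem N g (by rw [h]; trivial)

/-- The largest subfunctor whose value at `c` is zero. -/
def cogeneratedBy (F : A ⥤ ModuleCat.{w} K) (c : A) : stableFamilies F :=
  ⟨fun x => ⨅ g : x ⟶ c, LinearMap.ker (F.map g).hom, fun x y f => by
    rintro _ ⟨m, hm, rfl⟩
    rw [Submodule.mem_iInf]
    intro g
    have := (Submodule.mem_iInf _).1 hm (f ≫ g)
    simpa using this⟩

lemma le_cogeneratedBy {N : stableFamilies F} {c : A} :
    N ≤ cogeneratedBy F c ↔ N.1 c = ⊥ := by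
  refine ⟨fun h => bot_unique fun m hm => ?_, fun h x m hm => ?_⟩
  · have := (Submodule.mem_iInf _).1 (h c hm) (𝟙 c)
    simpa using this
  · refine (Submodule.mem_iInf _).2 fun g => ?_
    have := map_mem N g hm
    rw [h] at this
    exact this

end stableFamilies

open stableFamilies

instance : IsModularLattice (Subobject F) where
  sup_inf_le_assoc_of_le {a} b {c} hac := by
    rw [← (subobjectOrderIso F).le_iff_le, map_inf, map_sup, map_sup, map_inf]
    have h : subobjectOrderIso F a ≤ subobjectOrderIso F c := (subobjectOrderIso F).monotone hac
    exact fun x => IsModularLattice.sup_inf_le_assoc_of_le _ (h x)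

/-- A maximal element of an upward directed family is its greatest element, hence its supremum;
dually for minimal elements. -/
lemma HasFiniteLength.isFiniteType_and_isCofiniteType (hF : HasFiniteLength F) :
    IsFiniteType F ∧ IsCofiniteType F := by
  obtain ⟨n, s, h0, hn, hs⟩ := hF
  obtain ⟨hgt, hlt⟩ := wellFounded_of_covBy s h0 hn hs
  refine ⟨fun S hne hdir hlub => ?_, fun S hne hdir hglb => ?_⟩
  · obtain ⟨m, hm, hmax⟩ := hgt.wf.has_min S hne
    have hle : ∀ t ∈ S, t ≤ m := by
      intro t ht
      obtain ⟨z, hz, hmz, htz⟩ := hdir m hm t ht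
      rwa [← hmz.eq_of_not_lt (hmax z hz)] at htz
    rwa [← top_unique (hlub.2 hle)]
  · obtain ⟨m, hm, hmin⟩ := hlt.wf.has_min S hne
    have hle : ∀ t ∈ S, m ≤ t := by
      intro t ht
      obtain ⟨z, hz, hmz, htz⟩ := hdir m hm t ht
      have hmz' : z ≤ m := hmz
      rwa [hmz'.eq_of_not_lt (hmin z hz)] at htz
    rwa [← bot_unique (hglb.2 hle)]

lemma stableFamilies.eq_top_of_retract (N : stableFamilies F) {c c' : A} {i : c ⟶ c'} {r : c' ⟶ c}
    (hir : i ≫ r = 𝟙 c) (h : N.1 c' = ⊤) : N.1 c = ⊤ := by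
  refine top_unique fun m _ => ?_
  have := map_mem N r (m := F.map i m) (by rw [h]; trivial)
  rwa [← ConcreteCategory.comp_apply, ← F.map_comp, hir, F.map_id] at this

lemma stableFamilies.eq_bot_of_retract (N : stableFamilies F) {c c' : A} {i : c ⟶ c'} {r : c' ⟶ c}
    (hir : i ≫ r = 𝟙 c) (h : N.1 c' = ⊥) : N.1 c = ⊥ := by
  refine bot_unique fun m hm => ?_
  have h1 := map_mem N i hm
  rw [h, Submodule.mem_bot] at h1
  have h2 : F.map r (F.map i m) = m := by
    rw [← ConcreteCategory.comp_apply, ← F.map_comp, hir, F.map_id]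
    rfl
  rw [Submodule.mem_bot, ← h2, h1, map_zero]

variable [Preadditive A] [HasZeroObject A] [HasBinaryBiproducts A]

open scoped ZeroObject

/-- The subfunctors `generatedBy F c` have union `F`, and they are directed because `c` and `c'` are
retracts of `c ⊞ c'`; so one of them is `F`. -/
lemma IsFiniteType.exists_isGeneratedBy (hF : IsFiniteType F) : ∃ c, IsGeneratedBy F c := by
  let e := subobjectOrderIso F
  obtain ⟨c, hc⟩ := hF (Set.range fun c => e.symm (generatedBy F c))
    ⟨_, Set.mem_range_self (0 : A)⟩ (by
      rintro _ ⟨c, rfl⟩ _ ⟨c', rfl⟩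
      refine ⟨_, Set.mem_range_self (c ⊞ c'), e.symm.monotone ?_, e.symm.monotone ?_⟩
      · exact generatedBy_le.2 (eq_top_of_retract _ biprod.inl_fst (generatedBy_le.1 le_rfl))
      · exact generatedBy_le.2 (eq_top_of_retract _ biprod.inr_snd (generatedBy_le.1 le_rfl)))
    ⟨fun _ _ => le_top, fun T hT => by
      refine e.le_iff_le.1 fun x => ?_
      have : generatedBy F x ≤ e T := by
        rw [← e.symm_apply_le]
        exact hT (Set.mem_range_self x)
      rw [generatedBy_le.1 this]
      exact le_top⟩
  refine ⟨c, fun x Z a b h => ?_⟩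
  have htop : ∀ N : stableFamilies F, N ≤ generatedBy F c := fun N => by
    rw [← e.symm.le_iff_le]
    exact le_top.trans hc.ge
  let N₀ : stableFamilies F := ⟨⊤, fun x y f => le_top⟩
  ext m
  have hm : m ∈ (generatedBy F c).1 x := htop N₀ x trivial
  have hle : (generatedBy F c).1 x ≤ LinearMap.eqLocus a.hom b.hom := by
    refine iSup_le fun g => ?_
    rintro _ ⟨m', rfl⟩
    exact ConcreteCategory.congr_hom (h g) m'
  exact hle hm

/-- Dually, the subfunctors `cogeneratedBy F c` are directed downward with zero intersection, so one
of them is zero. -/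
lemma IsCofiniteType.exists_isCogeneratedBy (hF : IsCofiniteType F) :
    ∃ c, IsCogeneratedBy F c := by
  let e := subobjectOrderIso F
  obtain ⟨c, hc⟩ := hF (Set.range fun c => e.symm (cogeneratedBy F c))
    ⟨_, Set.mem_range_self (0 : A)⟩ (by
      rintro _ ⟨c, rfl⟩ _ ⟨c', rfl⟩
      refine ⟨_, Set.mem_range_self (c ⊞ c'), e.symm.monotone ?_, e.symm.monotone ?_⟩
      · exact le_cogeneratedBy.2 (eq_bot_of_retract _ biprod.inl_fst (le_cogeneratedBy.1 le_rfl))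
      · exact le_cogeneratedBy.2 (eq_bot_of_retract _ biprod.inr_snd (le_cogeneratedBy.1 le_rfl)))
    ⟨fun _ _ => bot_le, fun T hT => by
      refine e.le_iff_le.1 fun x => ?_
      have : e T ≤ cogeneratedBy F x := by
        rw [← e.le_symm_apply]
        exact hT (Set.mem_range_self x)
      rw [le_cogeneratedBy.1 this]
      exact bot_le⟩
  refine ⟨c, fun x Z a b h => ?_⟩
  have hbot : ∀ N : stableFamilies F, cogeneratedBy F c ≤ N := fun N => by
    rw [← e.symm.le_iff_le]
    exact hc.le.trans bot_le
  let N₀ : stableFamilies F := ⟨⊥, fun x y f => by simp⟩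
  ext m
  have hm : a m - b m ∈ (cogeneratedBy F c).1 x := by
    refine (Submodule.mem_iInf _).2 fun g => ?_
    rw [LinearMap.mem_ker, map_sub, sub_eq_zero]
    exact ConcreteCategory.congr_hom (h g) m
  exact sub_eq_zero.1 ((Submodule.mem_bot K).1 (hbot N₀ x hm))

end Subfunctors

/-! ### Finiteness conditions applied to the bifunctor -/

section Decomposition

variable {A : Type u} [Category.{v} A] [Preadditive A] [HasZeroObject A]
  [HasBinaryBiproducts A] {K : Type k} [Field K] {F : A ⥤ ModuleCat.{w} K}
  (hF : HasFiniteDimensionalValues F)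

/-- For part 1 this is the only point where the finiteness hypothesis enters: it makes the period
ideal of each section cotrivial. -/
lemma isAntipolynomialFst_bifunctor (h : IsFiniteType F ∨ IsCofiniteType F) :
    IsAntipolynomialFst (bifunctor hF) := by
  intro y
  refine isAntipolynomial_of_periodIdeal _ fun x x' => ?_
  obtain h | h := h
  · obtain ⟨c, hc⟩ := h.exists_isGeneratedBy
    exact (hc.sectL (diagBifunctorIso hF) y).isCotrivialSubgroup_periodIdeal
      (exists_subgroup_bifunctor hF y) x x'
  · obtain ⟨c, hc⟩ := h.exists_isCogeneratedBy
    exact (hc.sectL (diagBifunctorIso hF) y).isCotrivialSubgroup_periodIdeal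
      (exists_subgroup_bifunctor hF y) x x'

omit [HasZeroObject A] in
lemma nonempty_iso_bifunctor {B : A × A ⥤ ModuleCat.{w} K} (h₁ : IsAntipolynomialFst B)
    (h₂ : IsPolyHomialSnd B) (φ : F ≅ Functor.diag A ⋙ B) : Nonempty (B ≅ bifunctor hF) :=
  ⟨isoBifunctor hF (fun x => φ.app x) h₁ h₂ fun u => φ.hom.naturality u⟩

lemma IsPolyHomialSnd.isPolynomialSnd {B : A × A ⥤ ModuleCat.{w} K} (hB : IsPolyHomialSnd B)
    (φ : F ≅ Functor.diag A ⋙ B) (h : IsFiniteType F) (h' : IsCofiniteType F) :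
    IsPolynomialSnd B := by
  intro x
  obtain ⟨c, hc⟩ := h.exists_isGeneratedBy
  obtain ⟨c', hc'⟩ := h'.exists_isCogeneratedBy
  exact (hB x).isPolynomial (hc.sectR φ x) (hc'.sectR φ x)

omit [HasZeroObject A] [HasBinaryBiproducts A] in
lemma IsPolynomialSnd.isPolyHomialSnd {B : A × A ⥤ ModuleCat.{w} K} (hB : IsPolynomialSnd B) :
    IsPolyHomialSnd B :=
  fun x y z => (hB x).imp fun _ hd => hd y z

end Decomposition

end PolyFct

theorem mainTheorem1 {A : Type u} [Category.{v} A] [Preadditive A] [HasFiniteBiproducts A]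
    {K : Type k} [Field K] (F : A ⥤ ModuleCat.{w} K)
    (hF : PolyFct.HasFiniteDimensionalValues F) :
    (PolyFct.IsFiniteType F ∨ PolyFct.IsCofiniteType F →
      ∃ B : A × A ⥤ ModuleCat.{w} K,
        (PolyFct.IsAntipolynomialFst B ∧ PolyFct.IsPolyHomialSnd B ∧
          Nonempty (F ≅ Functor.diag A ⋙ B)) ∧
        ∀ B' : A × A ⥤ ModuleCat.{w} K,
          PolyFct.IsAntipolynomialFst B' → PolyFct.IsPolyHomialSnd B' →
          Nonempty (F ≅ Functor.diag A ⋙ B') → Nonempty (B' ≅ B)) ∧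
    (PolyFct.IsFiniteType F ∧ PolyFct.IsCofiniteType F →
      (∃ B : A × A ⥤ ModuleCat.{w} K,
        (PolyFct.IsAntipolynomialFst B ∧ PolyFct.IsPolynomialSnd B ∧
          Nonempty (F ≅ Functor.diag A ⋙ B)) ∧
        ∀ B' : A × A ⥤ ModuleCat.{w} K,
          PolyFct.IsAntipolynomialFst B' → PolyFct.IsPolynomialSnd B' →
          Nonempty (F ≅ Functor.diag A ⋙ B') → Nonempty (B' ≅ B)) ∧
      ∀ B : A × A ⥤ ModuleCat.{w} K,
        PolyFct.IsAntipolynomialFst B → PolyFct.IsPolyHomialSnd B →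
        Nonempty (F ≅ Functor.diag A ⋙ B) → PolyFct.IsPolynomialSnd B) ∧
    (PolyFct.HasFiniteLength F → PolyFct.IsFiniteType F ∧ PolyFct.IsCofiniteType F) := by
  have := hasBinaryBiproducts_of_finite_biproducts A
  have : HasZeroObject A := inferInstance
  refine ⟨fun h => ⟨PolyFct.bifunctor hF, ⟨PolyFct.isAntipolynomialFst_bifunctor hF h,
      PolyFct.isPolyHomialSnd_bifunctor hF, ⟨PolyFct.diagBifunctorIso hF⟩⟩,
      fun B' h₁ h₂ ⟨φ⟩ => PolyFct.nonempty_iso_bifunctor hF h₁ h₂ φ⟩,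
    fun h => ⟨⟨PolyFct.bifunctor hF, ⟨PolyFct.isAntipolynomialFst_bifunctor hF (Or.inl h.1),
      (PolyFct.isPolyHomialSnd_bifunctor hF).isPolynomialSnd (PolyFct.diagBifunctorIso hF) h.1 h.2,
      ⟨PolyFct.diagBifunctorIso hF⟩⟩,
      fun B' h₁ h₂ ⟨φ⟩ => PolyFct.nonempty_iso_bifunctor hF h₁ h₂.isPolyHomialSnd φ⟩,
      fun B _ h₂ ⟨φ⟩ => h₂.isPolynomialSnd φ h.1 h.2⟩,
    fun h => h.isFiniteType_and_isCofiniteType⟩
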